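/- Let $P_8$ and $C_8$ denote the path and the cycle with exactly $8$ edges, let $K_m$ be the complete graph on $m$ vertices and $\overline{K}_n$ the graph with $n$ vertices and no edges. The wreath product $G\circ H$ has vertex set $V(G)\times V(H)$, with $(g_1,h_1)$ and $(g_2,h_2)$ adjacent when $g_1g_2\in E(G)$, or $g_1=g_2$ and $h_1h_2\in E(H)$. For a graph $G$ and $\lambda\ge 1$, $G(\lambda)$ is the multigraph obtained by replacing every edge of $G$ by $\lambda$ parallel edges. For a finite loopless multigraph $M$ with $t$ vertices of odd degree, call a pair $(p,q)$ of nonnegative integers admissible if $8(p+q)=|E(M)|$, $p\ge t/2$, and, in case $t=0$, $p\neq 1$. (These conditions are clearly necessary for the edges of $M$ to be partitioned into $p$ copies of $P_8$ and $q$ copies of $C_8$.) Say that $M$ admits a $(8;p,q)$-decomposition if it has a partition of its edges into copies of $P_8$ and $C_8$, and if moreover for every admissible pair $(p,q)$ it has such a partition into exactly $p$ copies of $P_8$ and $q$ copies of $C_8$. **Theorem.** Let $m\ge 2$, $n\ge 1$ and $\lambda\ge 1$ be integers. Then $(K_m\circ\overline{K}_n)(\lambda)$ admits a $(8;p,q)$-decomposition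 if and only if $$8\ \Big|\ \frac{\lambda n^2 m(m-1)}{2}\quad\text{and}\quad mn\ge 9 .$$ Moreover, both conditions already hold as soon as $(K_m\circ\overline{K}_n)(\lambda)$ can be decomposed into $p$ copies of $P_8$ and $q$ copies of $C_8$ for a single pair $(p,q)$ with $p\ge 1$. -/

import Mathlib

/-- A finite loopless multigraph on the vertex set `V`: `mult s(v, w)` is the number of parallel
edges joining `v` and `w`. -/
structure Multigraph (V : Type*) where
  mult : Sym2 V → ℕ
  loopless : ∀ e : Sym2 V, e.IsDiag → mult e = 0

namespace Multigraph

variable {V : Type*}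

/-- The simple graph of adjacent pairs of vertices. -/
def toSimpleGraph (M : Multigraph V) : SimpleGraph V where
  Adj v w := 0 < M.mult s(v, w)
  symm := ⟨fun v w h => by rwa [Sym2.eq_swap]⟩
  loopless := ⟨fun v h => by
    have := M.loopless s(v, v) rfl
    omega⟩

/-- The number of edges, counted with multiplicity. -/
def edgeCount [Fintype V] [DecidableEq V] (M : Multigraph V) : ℕ :=
  ∑ e : Sym2 V, M.mult e

/-- The degree of a vertex, counted with multiplicity. -/
def degree [Fintype V] (M : Multigraph V) (v : V) : ℕ :=
  ∑ w : V, M.mult s(v, w)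

/-- The number of vertices of odd degree. -/
def oddCount [Fintype V] (M : Multigraph V) : ℕ :=
  (Finset.univ.filter fun v : V => Odd (M.degree v)).card

/-- `M` is the edge-disjoint union of `p` paths with `k` edges and `q` cycles with `k` edges
(for `k ≥ 3`). Each piece is a copy (the image of an injective homomorphism) of the standard path
or cycle, and every edge `e` of `M` lies in exactly `M.mult e` of the pieces; that is, the edge
multisets of the pieces add up to the edge multiset of `M`. -/
def IsPathCycleDecomposable (M : Multigraph V) (k p q : ℕ) : Prop :=
  ∃ (P : Fin p → SimpleGraph.Copy (SimpleGraph.pathGraph (k + 1)) M.toSimpleGraph)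
    (C : Fin q → SimpleGraph.Copy (SimpleGraph.cycleGraph k) M.toSimpleGraph),
    ∀ e : Sym2 V,
      {i : Fin p | e ∈ (P i).toSubgraph.edgeSet}.ncard +
        {j : Fin q | e ∈ (C j).toSubgraph.edgeSet}.ncard = M.mult e

/-- The pairs `(p, q)` not excluded by counting edges and by parity: the total number of edges is
`k * (p + q)`; every vertex of odd degree is an end of one of the `p` paths; and if all degrees are
even then there is not exactly one path (its two ends would have odd degree). -/
def IsAdmissiblePair [Fintype V] [DecidableEq V] (M : Multigraph V) (k p q : ℕ) : Prop :=
  k * (p + q) = M.edgeCount ∧ M.oddCount ≤ 2 * p ∧ (M.oddCount = 0 → p ≠ 1)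

/-- `M` admits a `(k; p, q)`-decomposition: `M` decomposes into paths and cycles with `k` edges, and
it does so with `p` paths and `q` cycles for every admissible pair `(p, q)`. -/
def AdmitsPathCycleDecomposition [Fintype V] [DecidableEq V] (M : Multigraph V) (k : ℕ) : Prop :=
  (∃ p q : ℕ, M.IsPathCycleDecomposable k p q) ∧
    ∀ p q : ℕ, M.IsAdmissiblePair k p q → M.IsPathCycleDecomposable k p q

end Multigraph

namespace SimpleGraph

variable {V W : Type*}

open Classical in
/-- The multigraph `G(l)` obtained by replacing every edge of `G` by `l` parallel edges. -/
noncomputable def fold (G : SimpleGraph V) (l : ℕ) : Multigraph V where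
  mult e := if e ∈ G.edgeSet then l else 0
  loopless _ he := if_neg fun h => G.not_isDiag_of_mem_edgeSet h he

/-- The wreath product of `G` and `H`. -/
def wreathProduct (G : SimpleGraph V) (H : SimpleGraph W) : SimpleGraph (V × W) where
  Adj x y := G.Adj x.1 y.1 ∨ (x.1 = y.1 ∧ H.Adj x.2 y.2)
  symm := ⟨fun _ _ h => h.imp (fun h => h.symm) fun h => ⟨h.1.symm, h.2.symm⟩⟩
  loopless := ⟨fun _ h => h.elim (fun h => G.irrefl h) fun h => H.irrefl h.2⟩

end SimpleGraph

/-!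
The conditions are necessary since each piece has `8` edges and a path with `8` edges has `9`
vertices. If there is no path in the given decomposition and there are only `8` vertices, then all
degrees are even and there are at least two pieces, so that a decomposition into paths only is
admissible; but it does not exist.

For the converse, a multigraph is encoded as a weight `W : V → V → ℕ`, and `Dec W p q` says that it
is the edge-disjoint union of `p` paths and `q` cycles with `8` edges. Paths are produced from
cycles by trading: two or three `8`-cycles through a vertex `x` become as many paths if they pass on
an edge at `x` to each other in a cyclic way, under a condition on the other ends of these edges
(`dec_trade_pair`, `dec_trade_triple`). Therefore the union of a list of cycles that splits into
pairs for trading, and also into a triple and pairs (with at most one cycle left over), decomposes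
with every number `p ≠ 1` of paths (`FullWith.of_pairs`). Multigraphs with this property, and with a
number of pieces other than `1` and `2`, are called full; they are closed under edge-disjoint union
(`Full.add`). It remains to put together the complete equipartite multigraphs from full ones.

* Finitely many small complete bipartite and equipartite multigraphs are full by explicit lists of
  cycles, which the kernel checks (`full_of_certificateOK`). Unions of them give the complete
  bipartite multigraphs that are needed (`fullBip_one`, `fullBip_two_even`, `fullBip_two`,
  `fullBip_four`, `fullBip_eight`), and the equipartite multigraphs with parts of even size and of
  size one, by induction on the number of parts.
* For parts of odd size `n ≥ 3`, a decomposition of `K_m(l)` into cycles is blown up: each `8`-cycle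
  becomes `n * n` cycles, and these form a full multigraph (`fullWith_blow`). For few parts there
  are again direct constructions. This settles all cases with even degrees (`fullMulti_of_dvd`).
* If the degrees are odd, then `l` and `n` are odd and `m` is a multiple of `16`. The complete graph
  `K_16` is the union of `8` paths and `7` cycles (`exists_dec_residueW_sixteen`). In the blow-up, a
  path becomes `n` paths, one for each label, and `n * n - n` cycles, each of which runs forth along
  one half of the path and back again with other labels (`sum_layer_add_sum_lens`). This gives the
  least possible number of paths, half of the number of vertices; larger numbers come from trades
  with the full parts (`exists_hasRange_of_odd`).
-/

namespace PathCycle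

/-! ### Weights of edges, paths and cycles -/

section Weights

variable {U V : Type*} [DecidableEq U] [DecidableEq V]

/-- The indicator of the unordered edge `ab`, evaluated at the pair `x`, `y`. Multigraphs are
encoded throughout as symmetric functions `V → V → ℕ`, so that edge-disjoint union is addition. -/
def edgeW (a b x y : V) : ℕ :=
  if (a = x ∧ b = y) ∨ (a = y ∧ b = x) then 1 else 0

/-- The number of times the walk visiting the vertices of a list in order runs along `xy`. -/
def trailW : List V → V → V → ℕ
  | a :: b :: t => edgeW a b + trailW (b :: t)
  | _ => 0

/-- The number of times the closed walk visiting the vertices of a list in order, and then returning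
to the first one, runs along `xy`. -/
def cycleW : List V → V → V → ℕ
  | a :: t => trailW (a :: (t ++ [a]))
  | [] => 0

/-- `Dec W p q`: the multigraph in which `x` and `y` are joined by `W x y` edges is the
edge-disjoint union of `p` paths with `8` edges and `q` cycles with `8` edges. The pieces are given
by their lists of vertices. -/
inductive Dec : (V → V → ℕ) → ℕ → ℕ → Prop
  | zero : Dec 0 0 0
  | path {W p q} (l : List V) (hl : l.length = 9) (hn : l.Nodup) (h : Dec W p q) :
      Dec (trailW l + W) (p + 1) q
  | cycle {W p q} (l : List V) (hl : l.length = 8) (hn : l.Nodup) (h : Dec W p q) :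
      Dec (cycleW l + W) p (q + 1)

theorem edgeW_swap (a b : V) : edgeW a b = edgeW b a := by
  funext x y
  simp only [edgeW]
  congr 1
  simp only [eq_iff_iff]
  tauto

@[simp] theorem trailW_nil : trailW ([] : List V) = 0 := rfl

@[simp] theorem trailW_singleton (a : V) : trailW [a] = 0 := rfl

@[simp] theorem trailW_cons_cons (a b : V) (t : List V) :
    trailW (a :: b :: t) = edgeW a b + trailW (b :: t) := rfl

@[simp] theorem cycleW_cons (a : V) (t : List V) :
    cycleW (a :: t) = trailW (a :: (t ++ [a])) := rfl

theorem trailW_append_pair (l : List V) (a b : V) :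
    trailW (l ++ [a, b]) = trailW (l ++ [a]) + edgeW a b := by
  induction l with
  | nil => simp
  | cons c t ih =>
    cases t with
    | nil => simp
    | cons d t =>
      simp only [List.cons_append, trailW_cons_cons] at ih ⊢
      rw [ih, add_assoc]

theorem trailW_reverse (l : List V) : trailW l.reverse = trailW l := by
  induction l with
  | nil => rfl
  | cons a t ih =>
    cases t with
    | nil => rfl
    | cons b t =>
      have : (a :: b :: t).reverse = t.reverse ++ [b, a] := by simp
      rw [this, trailW_append_pair, trailW_cons_cons, ← ih, add_comm, edgeW_swap]
      simp

theorem cycleW_rotate_one (a : V) (t : List V) : cycleW (t ++ [a]) = cycleW (a :: t) := by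
  cases t with
  | nil => rfl
  | cons b t =>
    simp only [List.cons_append, cycleW_cons, trailW_cons_cons, List.append_assoc]
    rw [show b :: (t ++ a :: ([] ++ [b])) = (b :: t) ++ [a, b] by simp, trailW_append_pair,
      add_comm]
    simp

theorem cycleW_rotate (l : List V) (k : ℕ) : cycleW (l.rotate k) = cycleW l := by
  induction k generalizing l with
  | zero => simp
  | succ k ih =>
    cases l with
    | nil => simp
    | cons a t => rw [List.rotate_cons_succ, ih, cycleW_rotate_one]

theorem cycleW_reverse (l : List V) : cycleW l.reverse = cycleW l := by
  cases l with
  | nil => rfl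
  | cons a t =>
    rw [List.reverse_cons, cycleW_rotate_one, cycleW_cons, cycleW_cons, ← trailW_reverse]
    simp

theorem trailW_ne_zero_mem {l : List V} {x y : V} (h : trailW l x y ≠ 0) : x ∈ l ∧ y ∈ l := by
  induction l with
  | nil => simp at h
  | cons a t ih =>
    cases t with
    | nil => simp at h
    | cons b t =>
      by_cases h' : trailW (b :: t) x y = 0
      · have : edgeW a b x y ≠ 0 := by
          simpa [h'] using h
        simp only [edgeW, ne_eq, ite_eq_right_iff, one_ne_zero, imp_false, not_not] at this
        rcases this with ⟨rfl, rfl⟩ | ⟨rfl, rfl⟩ <;> simp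
      · have := ih h'
        exact ⟨List.mem_cons_of_mem _ this.1, List.mem_cons_of_mem _ this.2⟩

theorem cycleW_ne_zero_mem {l : List V} {x y : V} (h : cycleW l x y ≠ 0) : x ∈ l ∧ y ∈ l := by
  cases l with
  | nil => exact absurd rfl h
  | cons a t =>
    have := trailW_ne_zero_mem h
    simpa [or_comm, or_assoc] using this

/-- Every vertex of a walk with at least one edge lies on an edge of it. -/
theorem exists_trailW_ne_zero {l : List V} (hl : 2 ≤ l.length) {x : V} (hx : x ∈ l) :
    ∃ y, trailW l x y ≠ 0 := by
  induction l with
  | nil => simp at hx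
  | cons a t ih =>
    cases t with
    | nil => simp at hl
    | cons b t =>
      rcases List.mem_cons.1 hx with rfl | hx
      · exact ⟨b, by simp [edgeW]⟩
      · cases t with
        | nil =>
          obtain rfl : x = b := by simpa using hx
          exact ⟨a, by simp [edgeW]⟩
        | cons c t =>
          obtain ⟨y, hy⟩ := ih (by simp) hx
          exact ⟨y, by rw [trailW_cons_cons, Pi.add_apply, Pi.add_apply]; omega⟩

theorem exists_cycleW_ne_zero {l : List V} (hl : 1 ≤ l.length) {x : V} (hx : x ∈ l) :
    ∃ y, cycleW l x y ≠ 0 := by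
  cases l with
  | nil => simp at hl
  | cons a t =>
    exact exists_trailW_ne_zero (l := a :: (t ++ [a])) (by simp)
      (by rcases List.mem_cons.1 hx with rfl | h <;> simp [*])

theorem edgeW_map {φ : U → V} {S : Set U} (hφ : Set.InjOn φ S) {a b x y : U} (ha : a ∈ S)
    (hb : b ∈ S) (hx : x ∈ S) (hy : y ∈ S) : edgeW (φ a) (φ b) (φ x) (φ y) = edgeW a b x y := by
  simp only [edgeW, hφ.eq_iff ha hx, hφ.eq_iff hb hy, hφ.eq_iff ha hy, hφ.eq_iff hb hx]

theorem trailW_map {φ : U → V} {S : Set U} (hφ : Set.InjOn φ S) {l : List U} (hl : ∀ a ∈ l, a ∈ S)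
    {x y : U} (hx : x ∈ S) (hy : y ∈ S) : trailW (l.map φ) (φ x) (φ y) = trailW l x y := by
  induction l with
  | nil => rfl
  | cons a t ih =>
    cases t with
    | nil => rfl
    | cons b t =>
      simp only [List.map_cons, trailW_cons_cons, Pi.add_apply] at ih ⊢
      rw [edgeW_map hφ (hl _ (by simp)) (hl _ (by simp)) hx hy,
        ih (fun c hc => hl c (List.mem_cons_of_mem _ hc))]

theorem cycleW_map {φ : U → V} {S : Set U} (hφ : Set.InjOn φ S) {l : List U} (hl : ∀ a ∈ l, a ∈ S)
    {x y : U} (hx : x ∈ S) (hy : y ∈ S) : cycleW (l.map φ) (φ x) (φ y) = cycleW l x y := by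
  cases l with
  | nil => rfl
  | cons a t =>
    have := trailW_map hφ (l := a :: (t ++ [a])) (x := x) (y := y)
      (by intro c hc; apply hl; simpa [or_comm, or_assoc] using hc) hx hy
    simpa using this

namespace Dec

theorem cast {W W' : V → V → ℕ} {p q p' q' : ℕ} (h : Dec W p q) (hW : W' = W) (hp : p' = p)
    (hq : q' = q) : Dec W' p' q' := by
  subst hW hp hq
  exact h

theorem add {W W' : V → V → ℕ} {p q p' q' : ℕ} (h : Dec W p q) (h' : Dec W' p' q') :
    Dec (W + W') (p + p') (q + q') := by
  induction h with
  | zero => simpa using h'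
  | path l hl hn _ ih => exact (path l hl hn ih).cast (add_assoc _ _ _) (by omega) (by omega)
  | cycle l hl hn _ ih => exact (cycle l hl hn ih).cast (add_assoc _ _ _) (by omega) (by omega)

theorem of_path {l : List V} (hl : l.length = 9) (hn : l.Nodup) : Dec (trailW l) 1 0 :=
  (path l hl hn zero).cast (add_zero _).symm rfl rfl

theorem of_cycle {l : List V} (hl : l.length = 8) (hn : l.Nodup) : Dec (cycleW l) 0 1 :=
  (cycle l hl hn zero).cast (add_zero _).symm rfl rfl

theorem sum {ι : Type*} (s : Finset ι) {W : ι → V → V → ℕ} {p q : ℕ}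
    (h : ∀ i ∈ s, Dec (W i) p q) : Dec (∑ i ∈ s, W i) (s.card * p) (s.card * q) := by
  classical
  induction s using Finset.induction_on with
  | empty => simpa using Dec.zero
  | insert i s hi ih =>
    rw [Finset.sum_insert hi, Finset.card_insert_of_notMem hi, Nat.succ_mul, Nat.succ_mul,
      add_comm _ p, add_comm _ q]
    exact (h i (by simp)).add (ih fun j hj => h j (by simp [hj]))

open Classical in
/-- Decompositions are carried along by maps that are injective on the support. No injectivity is
needed outside of the support, since every vertex of a piece lies on an edge. -/
theorem transfer {W : U → U → ℕ} {p q : ℕ} (h : Dec W p q) (S : Set U) (φ : U → V)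
    (hφ : Set.InjOn φ S) (hS : ∀ x y, W x y ≠ 0 → x ∈ S ∧ y ∈ S) {W' : V → V → ℕ}
    (h₁ : ∀ x ∈ S, ∀ y ∈ S, W' (φ x) (φ y) = W x y)
    (h₂ : ∀ u v, W' u v ≠ 0 → u ∈ φ '' S ∧ v ∈ φ '' S) : Dec W' p q := by
  -- the general induction step, for a piece `l` of weight `w l`
  have step : ∀ (l : List U) (wl W₀ : U → U → ℕ) (w' W' : V → V → ℕ),
      (∀ x ∈ l, ∃ y, wl x y ≠ 0) → (∀ x y, (wl + W₀) x y ≠ 0 → x ∈ S ∧ y ∈ S) →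
      (∀ u v, w' u v ≠ 0 → u ∈ l.map φ ∧ v ∈ l.map φ) →
      ((∀ x ∈ l, x ∈ S) → ∀ x ∈ S, ∀ y ∈ S, w' (φ x) (φ y) = wl x y) →
      (∀ x ∈ S, ∀ y ∈ S, W' (φ x) (φ y) = (wl + W₀) x y) →
      (∀ u v, W' u v ≠ 0 → u ∈ φ '' S ∧ v ∈ φ '' S) →
      (∀ x ∈ l, x ∈ S) ∧ ∃ W₁ : V → V → ℕ, W' = w' + W₁ ∧
        (∀ x y, W₀ x y ≠ 0 → x ∈ S ∧ y ∈ S) ∧ (∀ x ∈ S, ∀ y ∈ S, W₁ (φ x) (φ y) = W₀ x y) ∧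
        (∀ u v, W₁ u v ≠ 0 → u ∈ φ '' S ∧ v ∈ φ '' S) := by
    intro l wl W₀ w' W' hl hS hw' hw h₁ h₂
    have hlS : ∀ x ∈ l, x ∈ S := fun x hx => by
      obtain ⟨y, hy⟩ := hl x hx
      exact (hS x y (by rw [Pi.add_apply, Pi.add_apply]; omega)).1
    refine ⟨hlS, fun u v => W' u v - w' u v, ?_, ?_, ?_, ?_⟩
    · funext u v
      simp only [Pi.add_apply]
      by_cases h0 : w' u v = 0
      · omega
      · obtain ⟨hu, hv⟩ := hw' u v h0
        obtain ⟨x, hx, rfl⟩ := List.mem_map.1 hu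
        obtain ⟨y, hy, rfl⟩ := List.mem_map.1 hv
        rw [h₁ x (hlS x hx) y (hlS y hy), hw hlS x (hlS x hx) y (hlS y hy), Pi.add_apply,
          Pi.add_apply]
        omega
    · intro x y hxy
      exact hS x y (by rw [Pi.add_apply, Pi.add_apply]; omega)
    · intro x hx y hy
      simp only [h₁ x hx y hy, hw hlS x hx y hy, Pi.add_apply]
      omega
    · intro u v huv
      exact h₂ u v (by dsimp only at huv; omega)
  induction h generalizing W' with
  | zero =>
    have : W' = 0 := by
      funext u v
      by_contra h0
      obtain ⟨⟨x, hx, rfl⟩, ⟨y, hy, rfl⟩⟩ := h₂ u v h0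
      exact h0 (h₁ x hx y hy)
    rw [this]
    exact zero
  | path l hl hn _ ih =>
    obtain ⟨hlS, W₁, rfl, a, b, c⟩ := step l (trailW l) _ (trailW (l.map φ)) W'
      (fun x hx => exists_trailW_ne_zero (by omega) hx) hS (fun u v h => trailW_ne_zero_mem h)
      (fun h x hx y hy => trailW_map hφ h hx hy) h₁ h₂
    exact path _ (by simpa using hl)
      (List.Nodup.map_on (fun x hx y hy h => hφ (hlS x hx) (hlS y hy) h) hn) (ih a b c)
  | cycle l hl hn _ ih =>
    obtain ⟨hlS, W₁, rfl, a, b, c⟩ := step l (cycleW l) _ (cycleW (l.map φ)) W'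
      (fun x hx => exists_cycleW_ne_zero (by omega) hx) hS (fun u v h => cycleW_ne_zero_mem h)
      (fun h x hx y hy => cycleW_map hφ h hx hy) h₁ h₂
    exact cycle _ (by simpa using hl)
      (List.Nodup.map_on (fun x hx y hy h => hφ (hlS x hx) (hlS y hy) h) hn) (ih a b c)

end Dec

/-! ### Trading cycles for paths -/

/-- A cycle through the edge `xy` becomes a path when this edge is exchanged for an edge from `x` to
a vertex `w` outside the cycle. -/
theorem exists_dec_opened {x y w : V} {s : List V} (h : (x :: y :: s).length = 8)
    (n : (x :: y :: s).Nodup) (hw : w ∉ x :: y :: s) :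
    ∃ T : V → V → ℕ, Dec T 1 0 ∧ edgeW x y + T = cycleW (x :: y :: s) + edgeW x w := by
  refine ⟨trailW ((y :: s) ++ [x, w]), Dec.of_path (by simp at h ⊢; omega) ?_, ?_⟩
  · have : (y :: s ++ [x, w]).Perm (w :: x :: y :: s) := by
      simpa using (List.perm_append_comm (l₁ := y :: s) (l₂ := [x, w])).trans (List.Perm.swap _ _ _)
    exact this.nodup_iff.2 (List.nodup_cons.2 ⟨hw, n⟩)
  · rw [trailW_append_pair, ← add_assoc]
    simp

/-- Two cycles through `x` become two paths by exchanging an edge at `x`. -/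
theorem dec_trade_pair {x y z : V} {s t : List V} (h₁ : (x :: y :: s).length = 8)
    (n₁ : (x :: y :: s).Nodup) (h₂ : (x :: z :: t).length = 8) (n₂ : (x :: z :: t).Nodup)
    (hz : z ∉ x :: y :: s) (hy : y ∉ x :: z :: t) :
    Dec (cycleW (x :: y :: s) + cycleW (x :: z :: t)) 2 0 := by
  obtain ⟨T₁, d₁, e₁⟩ := exists_dec_opened h₁ n₁ hz
  obtain ⟨T₂, d₂, e₂⟩ := exists_dec_opened h₂ n₂ hy
  refine (d₁.add d₂).cast ?_ rfl rfl
  funext a b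
  have e₁ := congrFun (congrFun e₁ a) b
  have e₂ := congrFun (congrFun e₂ a) b
  simp only [Pi.add_apply] at e₁ e₂ ⊢
  omega

/-- Three cycles through `x` become three paths by passing on an edge at `x` cyclically. -/
theorem dec_trade_triple {x y z w : V} {s t u : List V} (h₁ : (x :: y :: s).length = 8)
    (n₁ : (x :: y :: s).Nodup) (h₂ : (x :: z :: t).length = 8) (n₂ : (x :: z :: t).Nodup)
    (h₃ : (x :: w :: u).length = 8) (n₃ : (x :: w :: u).Nodup)
    (hz : z ∉ x :: y :: s) (hw : w ∉ x :: z :: t) (hy : y ∉ x :: w :: u) :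
    Dec (cycleW (x :: y :: s) + (cycleW (x :: z :: t) + cycleW (x :: w :: u))) 3 0 := by
  obtain ⟨T₁, d₁, e₁⟩ := exists_dec_opened h₁ n₁ hz
  obtain ⟨T₂, d₂, e₂⟩ := exists_dec_opened h₂ n₂ hw
  obtain ⟨T₃, d₃, e₃⟩ := exists_dec_opened h₃ n₃ hy
  refine (d₁.add (d₂.add d₃)).cast ?_ rfl rfl
  funext a b
  have e₁ := congrFun (congrFun e₁ a) b
  have e₂ := congrFun (congrFun e₂ a) b
  have e₃ := congrFun (congrFun e₃ a) b
  simp only [Pi.add_apply] at e₁ e₂ e₃ ⊢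
  omega

/-- A path whose second vertex `x` lies on a cycle, and this cycle, become two paths by exchanging
the first edge `vx` of the path for an edge `xy` of the cycle. -/
theorem dec_trade_path {v x y : V} {s r : List V} (h₁ : (x :: y :: s).length = 8)
    (n₁ : (x :: y :: s).Nodup) (h₂ : (v :: x :: r).length = 9) (n₂ : (v :: x :: r).Nodup)
    (hv : v ∉ x :: y :: s) (hy : y ∉ v :: x :: r) :
    Dec (trailW (v :: x :: r) + cycleW (x :: y :: s)) 2 0 := by
  obtain ⟨T, d, e⟩ := exists_dec_opened h₁ n₁ hv
  have d' : Dec (trailW (y :: x :: r)) 1 0 := by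
    refine Dec.of_path (by simpa using h₂) (List.nodup_cons.2 ⟨?_, (List.nodup_cons.1 n₂).2⟩)
    exact fun h => hy (List.mem_cons_of_mem _ h)
  refine (d'.add d).cast ?_ rfl rfl
  rw [trailW_cons_cons, trailW_cons_cons, edgeW_swap v x, edgeW_swap y x]
  funext a b
  have e := congrFun (congrFun e a) b
  simp only [Pi.add_apply] at e ⊢
  omega

/-! ### Full decomposability -/

/-- `HasRange W k N`: the multigraph with weight `W` decomposes into `N` paths and cycles with any
number `p ≥ k` of paths. -/
def HasRange (W : V → V → ℕ) (k N : ℕ) : Prop :=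
  ∀ p q, p + q = N → k ≤ p → Dec W p q

/-- `FullWith W N`: the multigraph with weight `W` decomposes into `N` paths and cycles, with any
number of paths except one. The values `N = 1`, `N = 2` are excluded in order that unions of
edge-disjoint full multigraphs are full: `p` paths have to be distributed over the two parts with
neither part getting exactly one. -/
def FullWith (W : V → V → ℕ) (N : ℕ) : Prop :=
  N ≠ 1 ∧ N ≠ 2 ∧ ∀ p q, p + q = N → p ≠ 1 → Dec W p q

/-- `FullWith W N` for some `N`. -/
def Full (W : V → V → ℕ) : Prop :=
  ∃ N, FullWith W N

theorem FullWith.zero : FullWith (0 : V → V → ℕ) 0 := by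
  refine ⟨by simp, by simp, fun p q h _ => ?_⟩
  obtain ⟨rfl, rfl⟩ : p = 0 ∧ q = 0 := by omega
  exact Dec.zero

theorem FullWith.add {W W' : V → V → ℕ} {N N' : ℕ} (h : FullWith W N) (h' : FullWith W' N') :
    FullWith (W + W') (N + N') := by
  obtain ⟨n₁, n₂, h⟩ := h
  obtain ⟨n₁', n₂', h'⟩ := h'
  refine ⟨by omega, by omega, fun p q hpq hp => ?_⟩
  -- if exactly one path would be left for the second part, it gets two
  obtain ⟨a, b, hab, ha, hb, haN, hbN⟩ :
      ∃ a b, a + b = p ∧ a ≠ 1 ∧ b ≠ 1 ∧ a ≤ N ∧ b ≤ N' := by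
    by_cases c₁ : p ≤ N
    · exact ⟨p, 0, by omega, by omega, by omega, by omega, by omega⟩
    · by_cases c₂ : p = N + 1
      · by_cases c₃ : N = 0
        · omega
        · exact ⟨N - 1, 2, by omega, by omega, by omega, by omega, by omega⟩
      · exact ⟨N, p - N, by omega, by omega, by omega, by omega, by omega⟩
  exact ((h a (N - a) (by omega) ha).add (h' b (N' - b) (by omega) hb)).cast rfl (by omega)
    (by omega)

theorem FullWith.sum {ι : Type*} (s : Finset ι) {W : ι → V → V → ℕ} {N : ℕ}
    (h : ∀ i ∈ s, FullWith (W i) N) : FullWith (∑ i ∈ s, W i) (s.card * N) := by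
  classical
  induction s using Finset.induction_on with
  | empty => simpa using FullWith.zero
  | insert i s hi ih =>
    rw [Finset.sum_insert hi, Finset.card_insert_of_notMem hi, Nat.succ_mul, add_comm _ N]
    exact (h i (by simp)).add (ih fun j hj => h j (by simp [hj]))

theorem Full.zero : Full (0 : V → V → ℕ) :=
  ⟨0, FullWith.zero⟩

theorem Full.add {W W' : V → V → ℕ} : Full W → Full W' → Full (W + W')
  | ⟨_, h⟩, ⟨_, h'⟩ => ⟨_, h.add h'⟩

theorem Full.congr {W W' : V → V → ℕ} (h : Full W) (e : W' = W) : Full W' := e ▸ h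

theorem Full.transfer {W : U → U → ℕ} (h : Full W) (S : Set U) (φ : U → V)
    (hφ : Set.InjOn φ S) (hS : ∀ x y, W x y ≠ 0 → x ∈ S ∧ y ∈ S) {W' : V → V → ℕ}
    (h₁ : ∀ x ∈ S, ∀ y ∈ S, W' (φ x) (φ y) = W x y)
    (h₂ : ∀ u v, W' u v ≠ 0 → u ∈ φ '' S ∧ v ∈ φ '' S) : Full W' := by
  obtain ⟨N, n₁, n₂, h⟩ := h
  exact ⟨N, n₁, n₂, fun p q hpq hp => (h p q hpq hp).transfer S φ hφ hS h₁ h₂⟩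

theorem HasRange.transfer {W : U → U → ℕ} {k N : ℕ} (h : HasRange W k N) (S : Set U) (φ : U → V)
    (hφ : Set.InjOn φ S) (hS : ∀ x y, W x y ≠ 0 → x ∈ S ∧ y ∈ S) {W' : V → V → ℕ}
    (h₁ : ∀ x ∈ S, ∀ y ∈ S, W' (φ x) (φ y) = W x y)
    (h₂ : ∀ u v, W' u v ≠ 0 → u ∈ φ '' S ∧ v ∈ φ '' S) : HasRange W' k N :=
  fun p q hpq hp => (h p q hpq hp).transfer S φ hφ hS h₁ h₂

theorem HasRange.congr {W W' : V → V → ℕ} {k N : ℕ} (h : HasRange W k N) (e : W' = W) :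
    HasRange W' k N := e ▸ h

theorem HasRange.add {W W' : V → V → ℕ} {k N k' N' : ℕ} (h : HasRange W k N)
    (h' : HasRange W' k' N') (hk : k ≤ N) (hk' : k' ≤ N') :
    HasRange (W + W') (k + k') (N + N') := by
  intro p q hpq hp
  obtain ⟨a, b, hab, ha, hb, haN, hbN⟩ :
      ∃ a b, a + b = p ∧ k ≤ a ∧ k' ≤ b ∧ a ≤ N ∧ b ≤ N' := by
    by_cases c : p ≤ N + k'
    · exact ⟨p - k', k', by omega, by omega, by omega, by omega, by omega⟩
    · exact ⟨N, p - N, by omega, by omega, by omega, by omega, by omega⟩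
  exact ((h a (N - a) (by omega) ha).add (h' b (N' - b) (by omega) hb)).cast rfl (by omega)
    (by omega)

/-- As `k < N`, one path can be moved to the full part when a single one would be left for it. -/
theorem HasRange.add_full {W W' : V → V → ℕ} {k N : ℕ} (h : HasRange W k N) (hk : k < N)
    (h' : Full W') : ∃ N', N ≤ N' ∧ HasRange (W + W') k N' := by
  obtain ⟨M, n₁, n₂, h'⟩ := h'
  refine ⟨N + M, by omega, fun p q hpq hp => ?_⟩
  obtain ⟨a, b, hab, ha, hb, haN, hbM⟩ :
      ∃ a b, a + b = p ∧ k ≤ a ∧ b ≠ 1 ∧ a ≤ N ∧ b ≤ M := by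
    by_cases c₁ : p ≤ N
    · exact ⟨p, 0, by omega, by omega, by omega, by omega, by omega⟩
    · by_cases c₂ : p = N + 1
      · exact ⟨N - 1, 2, by omega, by omega, by omega, by omega, by omega⟩
      · exact ⟨N, p - N, by omega, by omega, by omega, by omega, by omega⟩
  exact ((h a (N - a) (by omega) ha).add (h' b (M - b) (by omega) hb)).cast rfl (by omega)
    (by omega)

/-- The members of a list of weights can be merged two by two into pairs of paths. -/
def Pairs : List (V → V → ℕ) → Prop
  | w :: w' :: L => Dec (w + w') 2 0 ∧ Pairs L
  | _ => True

/-- As many of the pairs as wanted are merged into paths, the other cycles are kept. -/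
theorem Pairs.dec : ∀ {L : List (V → V → ℕ)}, Pairs L → (∀ w ∈ L, Dec w 0 1) →
    ∀ k, 2 * k ≤ L.length → Dec L.sum (2 * k) (L.length - 2 * k)
  | [], _, _, k, hk => by
    obtain rfl : k = 0 := by simpa using hk
    exact Dec.zero
  | [w], _, hL, k, hk => by
    obtain rfl : k = 0 := by
      have : 2 * k ≤ 1 := hk
      omega
    exact (hL w (by simp)).cast (by simp) rfl rfl
  | w :: w' :: L, h, hL, k, hk => by
    have hL' : ∀ v ∈ L, Dec v 0 1 := fun v hv => hL v (by simp [hv])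
    have hk : 2 * k ≤ L.length + 2 := hk
    rcases Nat.eq_zero_or_pos k with rfl | hpos
    · refine ((hL w (by simp)).add ((hL w' (by simp)).add (h.2.dec hL' 0 (by simp)))).cast
        (by simp) rfl ?_
      simp only [List.length_cons]
      omega
    · refine (h.1.add (h.2.dec hL' (k - 1) (by omega))).cast (by simp [add_assoc]) (by omega) ?_
      simp only [List.length_cons]
      omega

/-- An even number of paths is obtained from pairs, an odd one from a triple and pairs. -/
theorem FullWith.of_pairs {w₁ w₂ w₃ : V → V → ℕ} {L : List (V → V → ℕ)}
    (hL : ∀ w ∈ w₁ :: w₂ :: w₃ :: L, Dec w 0 1) (h₃ : Dec (w₁ + (w₂ + w₃)) 3 0) (h : Pairs L)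
    (h' : Pairs (w₁ :: w₂ :: w₃ :: L)) : FullWith (w₁ :: w₂ :: w₃ :: L).sum (L.length + 3) := by
  refine ⟨by omega, by omega, fun p q hpq hp => ?_⟩
  rcases Nat.even_or_odd' p with ⟨k, rfl | rfl⟩
  · refine (h'.dec hL k ?_).cast rfl rfl ?_ <;> simp only [List.length_cons] <;> omega
  · refine (h₃.add (h.dec (fun v hv => hL v (by simp [hv])) (k - 1) (by omega))).cast
      (by simp [add_assoc]) (by omega) (by omega)

end Weights

/-! ### Certificates for full multigraphs -/

/-- All lists that describe the same cycle as a given one. -/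
def orientations (c : List ℕ) : List (List ℕ) :=
  (List.range c.length).map c.rotate ++ (List.range c.length).map c.reverse.rotate

/-- The first two vertices of both lists allow for the trade of `dec_trade_pair`. -/
def tradeAt : List ℕ → List ℕ → Bool
  | x :: y :: s, x' :: z :: t =>
    Nat.beq x x' && !(x :: y :: s).elem z && !(x' :: z :: t).elem y
  | _, _ => false

/-- The first two vertices of the three lists allow for the trade of `dec_trade_triple`. -/
def tradeAt₃ : List ℕ → List ℕ → List ℕ → Bool
  | x :: y :: s, x' :: z :: t, x'' :: w :: u =>
    Nat.beq x x' && Nat.beq x x'' && !(x :: y :: s).elem z && !(x' :: z :: t).elem w &&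
      !(x'' :: w :: u).elem y
  | _, _, _ => false

/-- Two cycles that can be exchanged for two paths, with suitable starting points and directions. -/
def canTrade (c d : List ℕ) : Bool :=
  (orientations c).any fun c => (orientations d).any fun d => tradeAt c d

/-- Three cycles that can be exchanged for three paths, with suitable starting points and
directions. The comparison of the first vertices is implied by `tradeAt₃`, and shortens the search.
-/
def canTrade₃ (c d e : List ℕ) : Bool :=
  (orientations c).any fun c => (orientations d).any fun d => c.head? == d.head? &&
    (orientations e).any fun e => tradeAt₃ c d e

/-- The test, on a list of cycles, of the property `Pairs` of their weights. -/
def pairsOK : List (List ℕ) → Bool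
  | c :: d :: L => canTrade c d && pairsOK L
  | _ => true

/-- The test, on a list of cycles, of the hypotheses of `FullWith.of_pairs`. -/
def tradesOK : List (List ℕ) → Bool
  | c :: d :: e :: L => canTrade₃ c d e && pairsOK L && pairsOK (c :: d :: e :: L)
  | _ => false

/-- The list consists of the vertices of a cycle with `8` edges. -/
def isCycle (c : List ℕ) : Bool :=
  c.length == 8 && decide c.Nodup

/-- `edgeCount x y l` is the number of occurrences of the edge `xy` in a list of edges. -/
def edgeCount (x y : ℕ) (l : List (ℕ × ℕ)) : ℕ :=
  l.countP fun e => (Nat.beq e.1 x && Nat.beq e.2 y) || (Nat.beq e.1 y && Nat.beq e.2 x)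

/-- The edges of the walk visiting the vertices of a list in order. -/
def trailEdges : List ℕ → List (ℕ × ℕ)
  | a :: b :: t => (a, b) :: trailEdges (b :: t)
  | _ => []

/-- The edges of the closed walk visiting the vertices of a list in order. -/
def cycleEdges : List ℕ → List (ℕ × ℕ)
  | a :: t => trailEdges (a :: (t ++ [a]))
  | [] => []

/-- The number of the position of the edge `e` in the lower triangular part of an `N × N` matrix. -/
def edgeCode (N : ℕ) (e : ℕ × ℕ) : ℕ :=
  max e.1 e.2 * N + min e.1 e.2

/-- The test that the edges `l` have ends below `N` and total weight `W`. The multiplicities are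
compared as the digits, in base `1024`, of a single number, which the kernel computes with fast
integer arithmetic. -/
def weightOK (N : ℕ) (W : ℕ → ℕ → ℕ) (l : List (ℕ × ℕ)) : Bool :=
  (l.all fun e => Nat.blt e.1 N && Nat.blt e.2 N) && Nat.blt l.length 1024 &&
    Nat.beq (l.map fun e => 1024 ^ edgeCode N e).sum
      ((List.range (N * N)).map fun k =>
        (bif Nat.ble (k % N) (k / N) then W (k / N) (k % N) else 0) * 1024 ^ k).sum

/-- The list `L` of cycles proves that the multigraph on `{0, …, N - 1}` with weight `W` is full. -/
def certificateOK (N : ℕ) (W : ℕ → ℕ → ℕ) (L : List (List ℕ)) : Bool :=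
  L.all isCycle && tradesOK L && weightOK N W (L.flatMap cycleEdges)

theorem cycleW_of_mem_orientations {c d : List ℕ} (h : d ∈ orientations c) (hc : isCycle c) :
    cycleW d = cycleW c ∧ d.length = 8 ∧ d.Nodup := by
  simp only [isCycle, Bool.and_eq_true, beq_iff_eq, decide_eq_true_eq] at hc
  simp only [orientations, List.mem_append, List.mem_map] at h
  rcases h with ⟨k, -, rfl⟩ | ⟨k, -, rfl⟩
  · exact ⟨cycleW_rotate c k, by simpa using hc.1, by simpa using hc.2⟩
  · exact ⟨by rw [cycleW_rotate, cycleW_reverse], by simpa using hc.1, by simpa using hc.2⟩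

theorem dec_of_canTrade {c d : List ℕ} (hc : isCycle c) (hd : isCycle d) (h : canTrade c d) :
    Dec (cycleW c + cycleW d) 2 0 := by
  simp only [canTrade, List.any_eq_true] at h
  obtain ⟨c', hc', d', hd', h⟩ := h
  obtain ⟨e₁, l₁, n₁⟩ := cycleW_of_mem_orientations hc' hc
  obtain ⟨e₂, l₂, n₂⟩ := cycleW_of_mem_orientations hd' hd
  rw [← e₁, ← e₂]
  match c', d', h with
  | x :: y :: s, x' :: z :: t, h =>
    simp only [tradeAt, Bool.and_eq_true, Nat.beq_eq, Bool.not_eq_true',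
      List.elem_eq_mem, decide_eq_false_iff_not] at h
    obtain ⟨⟨rfl, hz⟩, hy⟩ := h
    exact dec_trade_pair l₁ n₁ l₂ n₂ hz hy

theorem dec_of_canTrade₃ {c d e : List ℕ} (hc : isCycle c) (hd : isCycle d) (he : isCycle e)
    (h : canTrade₃ c d e) : Dec (cycleW c + (cycleW d + cycleW e)) 3 0 := by
  simp only [canTrade₃, List.any_eq_true, Bool.and_eq_true] at h
  obtain ⟨c', hc', d', hd', -, e', he', h⟩ := h
  obtain ⟨e₁, l₁, n₁⟩ := cycleW_of_mem_orientations hc' hc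
  obtain ⟨e₂, l₂, n₂⟩ := cycleW_of_mem_orientations hd' hd
  obtain ⟨e₃, l₃, n₃⟩ := cycleW_of_mem_orientations he' he
  rw [← e₁, ← e₂, ← e₃]
  match c', d', e', h with
  | x :: y :: s, x' :: z :: t, x'' :: w :: u, h =>
    simp only [tradeAt₃, Bool.and_eq_true, Nat.beq_eq, Bool.not_eq_true',
      List.elem_eq_mem, decide_eq_false_iff_not] at h
    obtain ⟨⟨⟨⟨rfl, rfl⟩, hz⟩, hw⟩, hy⟩ := h
    exact dec_trade_triple l₁ n₁ l₂ n₂ l₃ n₃ hz hw hy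

theorem dec_of_isCycle {c : List ℕ} (hc : isCycle c) : Dec (cycleW c) 0 1 := by
  simp only [isCycle, Bool.and_eq_true, beq_iff_eq, decide_eq_true_eq] at hc
  exact Dec.of_cycle hc.1 hc.2

theorem pairs_of_pairsOK : ∀ {L : List (List ℕ)}, (∀ c ∈ L, isCycle c) → pairsOK L →
    Pairs (L.map cycleW)
  | [], _, _ => trivial
  | [_], _, _ => trivial
  | c :: d :: L, hL, h => by
    simp only [pairsOK, Bool.and_eq_true] at h
    exact ⟨dec_of_canTrade (hL c (by simp)) (hL d (by simp)) h.1,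
      pairs_of_pairsOK (fun e he => hL e (by simp [he])) h.2⟩

theorem full_of_tradesOK {L : List (List ℕ)} (hL : ∀ c ∈ L, isCycle c) (h : tradesOK L) :
    Full (L.map cycleW).sum := by
  match L, hL, h with
  | c :: d :: e :: L, hL, h =>
    simp only [tradesOK, Bool.and_eq_true] at h
    refine ⟨_, FullWith.of_pairs ?_
      (dec_of_canTrade₃ (hL c (by simp)) (hL d (by simp)) (hL e (by simp)) h.1.1)
      (pairs_of_pairsOK (fun e he => hL e (by simp [he])) h.1.2)
      (pairs_of_pairsOK hL h.2)⟩
    intro w hw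
    rw [show cycleW c :: cycleW d :: cycleW e :: L.map cycleW = (c :: d :: e :: L).map cycleW
      from rfl, List.mem_map] at hw
    obtain ⟨c', hc', rfl⟩ := hw
    exact dec_of_isCycle (hL c' hc')

theorem edgeCount_trailEdges (x y : ℕ) : ∀ l : List ℕ, edgeCount x y (trailEdges l) = trailW l x y
  | [] => rfl
  | [_] => rfl
  | a :: b :: t => by
    have ih := edgeCount_trailEdges x y (b :: t)
    simp only [edgeCount, trailEdges, List.countP_cons, trailW_cons_cons, Pi.add_apply] at ih ⊢
    rw [ih, add_comm]
    simp [edgeW]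

theorem edgeCount_cycleEdges (x y : ℕ) (l : List ℕ) :
    edgeCount x y (cycleEdges l) = cycleW l x y := by
  cases l with
  | nil => rfl
  | cons a t => exact edgeCount_trailEdges x y _

theorem edgeCount_append (x y : ℕ) (l l' : List (ℕ × ℕ)) :
    edgeCount x y (l ++ l') = edgeCount x y l + edgeCount x y l' :=
  List.countP_append ..

theorem edgeCount_flatMap (x y : ℕ) {f : List ℕ → List (ℕ × ℕ)} {g : List ℕ → ℕ → ℕ → ℕ}
    (hfg : ∀ c, edgeCount x y (f c) = g c x y) (L : List (List ℕ)) :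
    edgeCount x y (L.flatMap f) = (L.map g).sum x y := by
  induction L with
  | nil => rfl
  | cons c L ih => simp [edgeCount_append, hfg, ih]

theorem edgeCount_symm (x y : ℕ) (l : List (ℕ × ℕ)) : edgeCount x y l = edgeCount y x l := by
  simp only [edgeCount, Bool.or_comm]

/-- Digits are determined by the number they represent. -/
theorem eq_of_sum_digits_eq {B : ℕ} {f g : ℕ → ℕ} (hf : ∀ k, f k < B) (hg : ∀ k, g k < B) :
    ∀ {K : ℕ}, ∑ k ∈ Finset.range K, f k * B ^ k = ∑ k ∈ Finset.range K, g k * B ^ k →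
      ∀ k < K, f k = g k := by
  intro K
  induction K generalizing f g with
  | zero => simp
  | succ K ih =>
    intro h
    rw [Finset.sum_range_succ', Finset.sum_range_succ'] at h
    have hB : 0 < B := (Nat.zero_le _).trans_lt (hf 0)
    have aux : ∀ f : ℕ → ℕ, ∑ k ∈ Finset.range K, f (k + 1) * B ^ (k + 1) =
        B * ∑ k ∈ Finset.range K, f (k + 1) * B ^ k := fun f => by
      rw [Finset.mul_sum]
      exact Finset.sum_congr rfl fun k _ => by ring
    rw [aux, aux, pow_zero, mul_one, mul_one] at h
    have h0 : f 0 = g 0 := by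
      have := congrArg (· % B) h
      simpa [Nat.mul_add_mod, Nat.mod_eq_of_lt (hf 0), Nat.mod_eq_of_lt (hg 0)] using this
    have hS := Nat.eq_of_mul_eq_mul_left hB (Nat.add_right_cancel (h0 ▸ h))
    intro k hk
    cases k with
    | zero => exact h0
    | succ k => exact ih (fun k => hf _) (fun k => hg _) hS k (by omega)

theorem sum_map_pow_eq (B : ℕ) {K : ℕ} {l : List ℕ} (hl : ∀ k ∈ l, k < K) :
    (l.map fun k => B ^ k).sum = ∑ k ∈ Finset.range K, l.count k * B ^ k := by
  induction l with
  | nil => simp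
  | cons a t ih =>
    rw [List.map_cons, List.sum_cons, ih fun k hk => hl k (List.mem_cons_of_mem _ hk)]
    have : ∀ k, (a :: t).count k * B ^ k = (if a = k then B ^ k else 0) + t.count k * B ^ k := by
      intro k
      rw [List.count_cons]
      split_ifs with h₁ h₂ h₂ <;> simp_all [add_mul, add_comm]
    simp only [this]
    rw [Finset.sum_add_distrib, Finset.sum_ite_eq, if_pos (Finset.mem_range.2 (hl a (by simp)))]

theorem edgeCode_eq_iff {N x y : ℕ} {e : ℕ × ℕ} (h₁ : e.1 < N) (h₂ : e.2 < N) (hx : x < N)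
    (hy : y ≤ x) : edgeCode N e = x * N + y ↔ (e.1 = x ∧ e.2 = y) ∨ (e.1 = y ∧ e.2 = x) := by
  have hN : 0 < N := by omega
  have h : edgeCode N e = x * N + y ↔ max e.1 e.2 = x ∧ min e.1 e.2 = y := by
    constructor
    · intro h
      have hd := congrArg (· / N) h
      have hm := congrArg (· % N) h
      simp only [edgeCode, mul_comm _ N, Nat.mul_add_div hN, Nat.mul_add_mod] at hd hm
      rw [Nat.div_eq_of_lt (by omega), Nat.div_eq_of_lt (by omega)] at hd
      rw [Nat.mod_eq_of_lt (by omega), Nat.mod_eq_of_lt (by omega)] at hm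
      exact ⟨by omega, hm⟩
    · rintro ⟨rfl, rfl⟩
      rfl
  rw [h]
  omega

theorem edgeCount_eq_of_weightOK {N : ℕ} {W : ℕ → ℕ → ℕ} {l : List (ℕ × ℕ)}
    (h : weightOK N W l) (hs : ∀ x y, W x y = W y x) (hN : ∀ x y, W x y ≠ 0 → x < N ∧ y < N)
    (hB : ∀ x y, W x y < 1024) (x y : ℕ) : edgeCount x y l = W x y := by
  simp only [weightOK, Bool.and_eq_true, List.all_eq_true, Nat.beq_eq, Nat.blt_eq] at h
  obtain ⟨⟨hl, hlen⟩, hW⟩ := h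
  -- the multiplicities in the lower triangle
  have key : ∀ x y, x < N → y ≤ x → edgeCount x y l = W x y := by
    intro x y hx hy
    have hlt : ∀ {a b : ℕ}, a < N → b < N → a * N + b < N * N := fun {a b} ha hb =>
      calc a * N + b < a * N + N := by omega
        _ = (a + 1) * N := by ring
        _ ≤ N * N := Nat.mul_le_mul_right _ ha
    have hW' : ((l.map (edgeCode N)).map fun k => 1024 ^ k).sum = ∑ k ∈ Finset.range (N * N),
        (bif Nat.ble (k % N) (k / N) then W (k / N) (k % N) else 0) * 1024 ^ k := by
      rw [List.map_map]
      exact hW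
    rw [sum_map_pow_eq (K := N * N)] at hW'
    · have := eq_of_sum_digits_eq (fun k => ?_) (fun k => ?_) hW' (x * N + y) (hlt hx (by omega))
      · rw [mul_comm x N, Nat.mul_add_div (by omega), Nat.mul_add_mod, Nat.mod_eq_of_lt (by omega),
          Nat.div_eq_of_lt (by omega), add_zero, Nat.ble_eq_true_of_le hy, cond_true] at this
        rw [← this, edgeCount, List.count, List.countP_map]
        refine List.countP_congr fun e he => ?_
        have := edgeCode_eq_iff (hl e he).1 (hl e he).2 hx hy
        simp only [Bool.or_eq_true, Bool.and_eq_true, Nat.beq_eq, Function.comp_apply, beq_iff_eq]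
        rw [mul_comm N x, this]
      · exact (List.count_le_length.trans (by simp)).trans_lt hlen
      · cases Nat.ble (k % N) (k / N)
        · simp
        · exact hB _ _
    · intro k hk
      obtain ⟨e, he, rfl⟩ := List.mem_map.1 hk
      have := hl e he
      exact hlt (by omega) (by omega)
  by_cases hxy : x < N ∧ y < N
  · rcases le_total y x with hle | hle
    · exact key x y hxy.1 hle
    · rw [edgeCount_symm, hs]
      exact key y x hxy.2 hle
  · have h0 : W x y = 0 := by
      by_contra h0
      exact hxy (hN x y h0)
    rw [h0, edgeCount, List.countP_eq_zero]
    intro e he hxye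
    have := hl e he
    simp only [Bool.or_eq_true, Bool.and_eq_true, Nat.beq_eq] at hxye
    omega

/-- Soundness of the certificates. -/
theorem full_of_certificateOK {N : ℕ} {W : ℕ → ℕ → ℕ} {L : List (List ℕ)}
    (h : certificateOK N W L) (hs : ∀ x y, W x y = W y x)
    (hN : ∀ x y, W x y ≠ 0 → x < N ∧ y < N) (hB : ∀ x y, W x y < 1024) : Full W := by
  simp only [certificateOK, Bool.and_eq_true, List.all_eq_true] at h
  refine (full_of_tradesOK h.1.1 h.1.2).congr ?_
  funext x y
  rw [← edgeCount_eq_of_weightOK h.2 hs hN hB, edgeCount_flatMap x y (edgeCount_cycleEdges x y)]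

/-- The images of the list `c` under the first `r` powers of `σ`. -/
def orbit (σ : ℕ → ℕ) : ℕ → List ℕ → List (List ℕ)
  | 0, _ => []
  | r + 1, c => c :: orbit σ r (c.map σ)

/-- The images of the lists in `L` under the first `r` powers of `σ`. -/
def develop (σ : ℕ → ℕ) (r : ℕ) (L : List (List ℕ)) : List (List ℕ) :=
  L.flatMap (orbit σ r)

/-- The weight of the complete multipartite multigraph with `m` parts of size `n`, the parts being
the residue classes modulo `m` in `{0, …, m * n - 1}`. -/
def residueW (m n l x y : ℕ) : ℕ :=
  if x < m * n ∧ y < m * n ∧ x % m ≠ y % m then l else 0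

/-- The weight of the complete bipartite multigraph with parts `{0, …, b - 1}` and
`{b, …, b + a - 1}`. -/
def intervalW (a b l x y : ℕ) : ℕ :=
  if x < a + b ∧ y < a + b ∧ decide (x < b) ≠ decide (y < b) then l else 0

theorem residueW_symm (m n l x y : ℕ) : residueW m n l x y = residueW m n l y x := by
  simp only [residueW]
  congr 1
  simp only [eq_iff_iff]
  tauto

theorem intervalW_symm (a b l x y : ℕ) : intervalW a b l x y = intervalW a b l y x := by
  simp only [intervalW]
  congr 1
  simp only [eq_iff_iff]
  tauto

theorem residueW_ne_zero {m n l x y : ℕ} (h : residueW m n l x y ≠ 0) : x < m * n ∧ y < m * n := by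
  simp only [residueW, ne_eq, ite_eq_right_iff, Classical.not_imp] at h
  exact ⟨h.1.1, h.1.2.1⟩

theorem intervalW_ne_zero {a b l x y : ℕ} (h : intervalW a b l x y ≠ 0) :
    x < a + b ∧ y < a + b := by
  simp only [intervalW, ne_eq, ite_eq_right_iff, Classical.not_imp] at h
  exact ⟨h.1.1, h.1.2.1⟩

theorem ite_lt_of_lt {P : Prop} [Decidable P] {l B : ℕ} (hl : l < B) :
    (if P then l else 0) < B := by
  split_ifs <;> omega

theorem full_residueW {m n l : ℕ} {L : List (List ℕ)}
    (h : certificateOK (m * n) (residueW m n l) L) (hl : l < 1024 := by norm_num) :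
    Full (residueW m n l) :=
  full_of_certificateOK h (residueW_symm m n l) (fun _ _ => residueW_ne_zero)
    (fun _ _ => ite_lt_of_lt hl)

theorem full_intervalW {a b l : ℕ} {L : List (List ℕ)}
    (h : certificateOK (a + b) (intervalW a b l) L) (hl : l < 1024 := by norm_num) :
    Full (intervalW a b l) :=
  full_of_certificateOK h (intervalW_symm a b l) (fun _ _ => intervalW_ne_zero)
    (fun _ _ => ite_lt_of_lt hl)

/-! ### Complete bipartite and complete equipartite multigraphs -/

/-- The weight of the complete bipartite multigraph with parts `A` and `B` and multiplicity `l`. -/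
def bipW (l : ℕ) (A B : Finset (ℕ × ℕ)) (x y : ℕ × ℕ) : ℕ :=
  if (x ∈ A ∧ y ∈ B) ∨ (x ∈ B ∧ y ∈ A) then l else 0

/-- The weight of the complete multipartite multigraph with multiplicity `l` and with the parts
`{i} × {0, …, n - 1}` for `i ∈ I`. -/
def multiW (n l : ℕ) (I : Finset ℕ) (x y : ℕ × ℕ) : ℕ :=
  if x.1 ∈ I ∧ y.1 ∈ I ∧ x.2 < n ∧ y.2 < n ∧ x.1 ≠ y.1 then l else 0

/-- `K_{a,b}(l)` is full. -/
def FullBip (l a b : ℕ) : Prop :=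
  ∀ A B : Finset (ℕ × ℕ), Disjoint A B → A.card = a → B.card = b → Full (bipW l A B)

/-- The complete multipartite multigraph with `m` parts of size `n` and multiplicity `l` is full. -/
def FullMulti (n l m : ℕ) : Prop :=
  ∀ I : Finset ℕ, I.card = m → Full (multiW n l I)

theorem exists_bijOn_of_card {α : Type*} [Inhabited α] {A : Finset α} {a : ℕ} (h : A.card = a) :
    ∃ f : ℕ → α, Set.BijOn f {k | k < a} A := by
  classical
  let e := A.equivFinOfCardEq h
  refine ⟨fun k => if hk : k < a then e.symm ⟨k, hk⟩ else default, ?_, ?_, ?_⟩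
  · intro k hk
    have hk : k < a := hk
    simp [hk]
  · intro k hk j hj hkj
    have hk : k < a := hk
    have hj : j < a := hj
    simp only [hk, hj, dif_pos] at hkj
    simpa using e.symm.injective (Subtype.ext hkj)
  · intro x hx
    exact ⟨e ⟨x, hx⟩, (e ⟨x, hx⟩).2, by simp⟩

theorem FullBip.symm {l a b : ℕ} (h : FullBip l a b) : FullBip l b a := fun A B hAB hA hB =>
  (h B A hAB.symm hB hA).congr <| by
    funext x y
    simp only [bipW]
    congr 1
    simp only [eq_iff_iff]
    tauto

theorem FullBip.add_mult {l l' a b : ℕ} (h : FullBip l a b) (h' : FullBip l' a b) :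
    FullBip (l + l') a b := fun A B hAB hA hB =>
  ((h A B hAB hA hB).add (h' A B hAB hA hB)).congr <| by
    funext x y
    simp only [bipW, Pi.add_apply]
    split_ifs <;> rfl

theorem FullBip.zero_mult (a b : ℕ) : FullBip 0 a b := fun A B _ _ _ =>
  Full.zero.congr <| by
    funext x y
    simp [bipW]

theorem FullBip.mul_mult {l a b : ℕ} (k : ℕ) (h : FullBip l a b) : FullBip (k * l) a b := by
  induction k with
  | zero => simpa using FullBip.zero_mult a b
  | succ k ih =>
    rw [Nat.succ_mul]
    exact ih.add_mult h

theorem FullBip.zero_right (l a : ℕ) : FullBip l a 0 := fun A B _ _ hB =>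
  Full.zero.congr <| by
    funext x y
    simp [bipW, Finset.card_eq_zero.1 hB]

theorem bipW_union {l : ℕ} {A B C : Finset (ℕ × ℕ)} (hBC : Disjoint B C)
    (hAB : Disjoint A B) (hAC : Disjoint A C) : bipW l A (B ∪ C) = bipW l A B + bipW l A C := by
  funext x y
  have h₁ := Finset.disjoint_left.1 hBC
  have h₂ := Finset.disjoint_left.1 hAB
  have h₃ := Finset.disjoint_left.1 hAC
  have hx₁ := @h₁ x
  have hx₂ := @h₂ x
  have hx₃ := @h₃ x
  have hy₁ := @h₁ y
  have hy₂ := @h₂ y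
  have hy₃ := @h₃ y
  simp only [bipW, Finset.mem_union, Pi.add_apply]
  clear h₁ h₂ h₃
  by_cases xA : x ∈ A <;> by_cases xB : x ∈ B <;> by_cases xC : x ∈ C <;> by_cases yA : y ∈ A <;>
    by_cases yB : y ∈ B <;> by_cases yC : y ∈ C <;> simp_all

theorem FullBip.add_right {l a b c : ℕ} (h : FullBip l a b) (h' : FullBip l a c) :
    FullBip l a (b + c) := by
  intro A D hAD hA hD
  obtain ⟨B, hBD, hB⟩ := Finset.exists_subset_card_eq (show b ≤ D.card by omega)
  have hC : (D \ B).card = c := by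
    rw [Finset.card_sdiff_of_subset hBD]
    omega
  have hAB : Disjoint A B := hAD.mono_right hBD
  have hAC : Disjoint A (D \ B) := hAD.mono_right Finset.sdiff_subset
  refine ((h A B hAB hA hB).add (h' A _ hAC hA hC)).congr ?_
  rw [← bipW_union Finset.disjoint_sdiff hAB hAC, Finset.union_sdiff_of_subset hBD]

theorem FullBip.add_left {l a b c : ℕ} (h : FullBip l a c) (h' : FullBip l b c) :
    FullBip l (a + b) c :=
  (h.symm.add_right h'.symm).symm

theorem FullBip.mul_left {l a b : ℕ} (k : ℕ) (h : FullBip l a b) : FullBip l (k * a) b := by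
  induction k with
  | zero => simpa using (FullBip.zero_right l b).symm
  | succ k ih =>
    rw [Nat.succ_mul]
    exact ih.add_left h

theorem FullBip.mul_right {l a b : ℕ} (k : ℕ) (h : FullBip l a b) : FullBip l a (k * b) :=
  (h.symm.mul_left k).symm

theorem fullBip_of_intervalW {l a b : ℕ} (h : Full (intervalW a b l)) : FullBip l a b := by
  intro A B hAB hA hB
  obtain ⟨f, hf⟩ := exists_bijOn_of_card hA
  obtain ⟨g, hg⟩ := exists_bijOn_of_card hB
  have hd := Finset.disjoint_left.1 hAB
  have hmemB : ∀ x, x < b → g x ∈ B := fun x hx => hg.mapsTo hx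
  have hmemA : ∀ x, x < a + b → ¬ x < b → f (x - b) ∈ A := fun x hx hx' =>
    hf.mapsTo (show x - b < a by omega)
  refine h.transfer {x | x < a + b} (fun x => if x < b then g x else f (x - b)) ?_
    (fun x y hxy => intervalW_ne_zero hxy) ?_ ?_
  · intro x hx y hy hxy
    have hx : x < a + b := hx
    have hy : y < a + b := hy
    dsimp only at hxy
    split_ifs at hxy with h₁ h₂ h₂
    · exact hg.injOn h₁ h₂ hxy
    · exact absurd (hmemB x h₁) (hxy ▸ hd (hmemA y hy h₂))
    · exact absurd (hmemB y h₂) (hxy ▸ hd (hmemA x hx h₁))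
    · have := hf.injOn (show x - b < a by omega) (show y - b < a by omega) hxy
      omega
  · intro x hx y hy
    have hx : x < a + b := hx
    have hy : y < a + b := hy
    simp only [bipW, intervalW, hx, hy, true_and]
    by_cases h₁ : x < b <;> by_cases h₂ : y < b
    · have n₁ : g x ∉ A := fun h => hd h (hmemB x h₁)
      have n₂ : g y ∉ A := fun h => hd h (hmemB y h₂)
      simp [h₁, h₂, n₁, n₂]
    · simp [h₁, h₂, hmemB x h₁, hmemA y hy h₂]
    · simp [h₁, h₂, hmemB y h₂, hmemA x hx h₁]
    · simp [h₁, h₂, hd (hmemA x hx h₁), hd (hmemA y hy h₂)]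
  · have memA : ∀ u ∈ A, u ∈ (fun x => if x < b then g x else f (x - b)) '' {x | x < a + b} := by
      intro u hu
      obtain ⟨k, hk, rfl⟩ := hf.surjOn hu
      have hk : k < a := hk
      exact ⟨k + b, show k + b < a + b by omega, by simp⟩
    have memB : ∀ u ∈ B, u ∈ (fun x => if x < b then g x else f (x - b)) '' {x | x < a + b} := by
      intro u hu
      obtain ⟨k, hk, rfl⟩ := hg.surjOn hu
      have hk : k < b := hk
      exact ⟨k, show k < a + b by omega, by simp [hk]⟩
    intro u v huv
    simp only [bipW, ne_eq, ite_eq_right_iff, Classical.not_imp] at huv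
    rcases huv.1 with h | h
    · exact ⟨memA u h.1, memB v h.2⟩
    · exact ⟨memB u h.1, memA v h.2⟩

theorem multiW_ne_zero {n l : ℕ} {I : Finset ℕ} {x y : ℕ × ℕ} (h : multiW n l I x y ≠ 0) :
    (x.1 ∈ I ∧ x.2 < n) ∧ y.1 ∈ I ∧ y.2 < n := by
  simp only [multiW, ne_eq, ite_eq_right_iff, Classical.not_imp] at h
  tauto

section Residue

variable {m n l : ℕ} {I : Finset ℕ} {f : ℕ → ℕ}

theorem residue_injOn (hf : Set.BijOn f {k | k < m} I) :
    Set.InjOn (fun x => (f (x % m), x / m)) {x | x < m * n} := by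
  intro x hx y hy hxy
  have hm : 0 < m := Nat.pos_of_ne_zero (by rintro rfl; simp at hx)
  simp only [Prod.mk.injEq] at hxy
  have := hf.injOn (Nat.mod_lt x hm) (Nat.mod_lt y hm) hxy.1
  rw [← Nat.div_add_mod x m, ← Nat.div_add_mod y m, this, hxy.2]

theorem multiW_residue (hf : Set.BijOn f {k | k < m} I) {x y : ℕ} (hx : x < m * n)
    (hy : y < m * n) :
    multiW n l I (f (x % m), x / m) (f (y % m), y / m) = residueW m n l x y := by
  have hm : 0 < m := Nat.pos_of_ne_zero (by rintro rfl; simp at hx)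
  have h₁ : x / m < n := Nat.div_lt_of_lt_mul hx
  have h₂ : y / m < n := Nat.div_lt_of_lt_mul hy
  have h₃ : f (x % m) ∈ I := hf.mapsTo (Nat.mod_lt x hm)
  have h₄ : f (y % m) ∈ I := hf.mapsTo (Nat.mod_lt y hm)
  have h₅ : f (x % m) = f (y % m) ↔ x % m = y % m :=
    hf.injOn.eq_iff (Nat.mod_lt x hm) (Nat.mod_lt y hm)
  simp [multiW, residueW, hx, hy, h₁, h₂, h₃, h₄, h₅]

theorem mem_image_residue (hf : Set.BijOn f {k | k < m} I) {u : ℕ × ℕ} (h₁ : u.1 ∈ I)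
    (h₂ : u.2 < n) : u ∈ (fun x => (f (x % m), x / m)) '' {x | x < m * n} := by
  obtain ⟨i, a⟩ := u
  obtain ⟨k, hk, rfl⟩ := hf.surjOn h₁
  have hk : k < m := hk
  refine ⟨m * a + k, ?_, ?_⟩
  · calc m * a + k < m * a + m := by omega
      _ = m * (a + 1) := by ring
      _ ≤ m * n := Nat.mul_le_mul_left _ h₂
  · simp [Nat.mod_eq_of_lt hk, Nat.mul_add_div (show 0 < m by omega),
      Nat.div_eq_of_lt hk]

theorem dec_multiW_of_residueW {p q : ℕ} (h : Dec (residueW m n l) p q) (hI : I.card = m) :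
    Dec (multiW n l I) p q := by
  obtain ⟨f, hf⟩ := exists_bijOn_of_card hI
  refine h.transfer _ _ (residue_injOn hf) (fun x y hxy => residueW_ne_zero hxy)
    (fun x hx y hy => multiW_residue hf hx hy) fun u v huv => ?_
  have := multiW_ne_zero huv
  exact ⟨mem_image_residue hf this.1.1 this.1.2, mem_image_residue hf this.2.1 this.2.2⟩

theorem fullMulti_of_residueW (h : Full (residueW m n l)) : FullMulti n l m := by
  obtain ⟨N, h₁, h₂, h⟩ := h
  exact fun I hI => ⟨N, h₁, h₂, fun p q hpq hp => dec_multiW_of_residueW (h p q hpq hp) hI⟩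

end Residue

theorem FullMulti.add_mult {n l l' m : ℕ} (h : FullMulti n l m) (h' : FullMulti n l' m) :
    FullMulti n (l + l') m := fun I hI =>
  ((h I hI).add (h' I hI)).congr <| by
    funext x y
    simp only [multiW, Pi.add_apply]
    split_ifs <;> rfl

theorem FullMulti.zero_mult (n m : ℕ) : FullMulti n 0 m := fun I _ =>
  Full.zero.congr <| by
    funext x y
    simp [multiW]

theorem FullMulti.mul_mult {n l m : ℕ} (k : ℕ) (h : FullMulti n l m) : FullMulti n (k * l) m := by
  induction k with
  | zero => simpa using FullMulti.zero_mult n m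
  | succ k ih =>
    rw [Nat.succ_mul]
    exact ih.add_mult h

theorem FullMulti.of_le_one (n l : ℕ) {m : ℕ} (hm : m ≤ 1) : FullMulti n l m := fun I hI =>
  Full.zero.congr <| by
    have := Finset.card_le_one.1 (hI.trans_le hm)
    funext x y
    simp only [multiW, Pi.zero_apply, ite_eq_right_iff]
    rintro ⟨hx, hy, -, -, hxy⟩
    exact absurd (this _ hx _ hy) hxy

theorem multiW_union (n l : ℕ) {J K : Finset ℕ} (hJK : Disjoint J K) :
    multiW n l (J ∪ K) = multiW n l J + multiW n l K +
      bipW l (J ×ˢ Finset.range n) (K ×ˢ Finset.range n) := by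
  funext ⟨i, a⟩ ⟨j, b⟩
  have h := Finset.disjoint_left.1 hJK
  have hi := @h i
  have hj := @h j
  simp only [multiW, bipW, Finset.mem_union, Pi.add_apply, Finset.mem_product, Finset.mem_range]
  clear h
  by_cases ha : a < n <;> by_cases hb : b < n <;> simp only [ha, hb, true_and, and_true, and_false,
    false_and, or_false, if_false, add_zero]
  by_cases iJ : i ∈ J <;> by_cases iK : i ∈ K <;> by_cases jJ : j ∈ J <;> by_cases jK : j ∈ K <;>
    simp_all
  all_goals
    rintro rfl
    simp_all

theorem FullMulti.add {n l a b : ℕ} (h : FullMulti n l a) (h' : FullMulti n l b)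
    (hab : FullBip l (a * n) (b * n)) : FullMulti n l (a + b) := by
  intro I hI
  obtain ⟨J, hJI, hJ⟩ := Finset.exists_subset_card_eq (show a ≤ I.card by omega)
  have hK : (I \ J).card = b := by
    rw [Finset.card_sdiff_of_subset hJI]
    omega
  have hd : Disjoint J (I \ J) := Finset.disjoint_sdiff
  rw [← Finset.union_sdiff_of_subset hJI, multiW_union n l hd]
  exact ((h J hJ).add (h' _ hK)).add (hab _ _ (Finset.disjoint_product.2 (Or.inl hd))
    (by simp [hJ]) (by simp [hK]))

theorem multiW_insert_union (n l : ℕ) {c : ℕ} {J K : Finset ℕ} (hJK : Disjoint J K) (hJ : c ∉ J)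
    (hK : c ∉ K) : multiW n l (insert c (J ∪ K)) = multiW n l (insert c J) +
      multiW n l (insert c K) + bipW l (J ×ˢ Finset.range n) (K ×ˢ Finset.range n) := by
  funext ⟨i, a⟩ ⟨j, b⟩
  have h := Finset.disjoint_left.1 hJK
  have hi := @h i
  have hj := @h j
  simp only [multiW, bipW, Finset.mem_union, Finset.mem_insert, Pi.add_apply, Finset.mem_product,
    Finset.mem_range]
  clear h
  by_cases ha : a < n <;> by_cases hb : b < n <;> simp only [ha, hb, true_and, and_true, and_false,
    false_and, or_false, if_false, add_zero]
  by_cases hij : i = j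
  · subst hij
    simp only [ne_eq, not_true_eq_false, and_false, if_false, zero_add]
    rw [if_neg]
    tauto
  have hij' : j ≠ i := Ne.symm hij
  by_cases ic : i = c
  · subst ic
    by_cases jJ : j ∈ J <;> by_cases jK : j ∈ K <;> simp_all
  by_cases jc : j = c
  · subst jc
    by_cases iJ : i ∈ J <;> by_cases iK : i ∈ K <;> simp_all
  by_cases iJ : i ∈ J <;> by_cases iK : i ∈ K <;> by_cases jJ : j ∈ J <;> by_cases jK : j ∈ K <;>
    simp_all

/-- Two complete multipartite multigraphs that share one part. -/
theorem FullMulti.add_share {n l a b : ℕ} (h : FullMulti n l (a + 1)) (h' : FullMulti n l (b + 1))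
    (hab : FullBip l (a * n) (b * n)) : FullMulti n l (a + b + 1) := by
  intro I hI
  obtain ⟨c, hc⟩ : I.Nonempty := Finset.card_pos.1 (by omega)
  have hI' : (I.erase c).card = a + b := by
    rw [Finset.card_erase_of_mem hc]
    omega
  obtain ⟨J, hJI, hJ⟩ := Finset.exists_subset_card_eq (show a ≤ (I.erase c).card by omega)
  have hK : (I.erase c \ J).card = b := by
    rw [Finset.card_sdiff_of_subset hJI]
    omega
  have hd : Disjoint J (I.erase c \ J) := Finset.disjoint_sdiff
  have hcJ : c ∉ J := fun h => Finset.notMem_erase c I (hJI h)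
  have hcK : c ∉ I.erase c \ J := fun h => Finset.notMem_erase c I (Finset.sdiff_subset h)
  rw [← Finset.insert_erase hc, ← Finset.union_sdiff_of_subset hJI,
    multiW_insert_union n l hd hcJ hcK]
  exact ((h _ (by rw [Finset.card_insert_of_notMem hcJ, hJ])).add
    (h' _ (by rw [Finset.card_insert_of_notMem hcK, hK]))).add
    (hab _ _ (Finset.disjoint_product.2 (Or.inl hd)) (by simp [hJ]) (by simp [hK]))

/-! ### The small complete bipartite and equipartite multigraphs -/

/-! Most of the certificates below consist of the images of a few cycles under a cyclic group of
automorphisms. The numerals in the names are the parameters of `FullBip` and `FullMulti`. -/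

/-- The permutation of `ℕ` that rotates, in each interval `{m * j, …, m * j + m - 1}`, the first `r`
elements, and fixes the other ones. -/
def rotate (m r x : ℕ) : ℕ :=
  bif Nat.blt (x % m) r then m * (x / m) + (x % m + 1) % r else x

section Base

set_option maxRecDepth 100000

theorem fullBip_2_4_5 : FullBip 2 4 5 :=
  fullBip_of_intervalW (full_intervalW (L := develop (rotate 9 5) 5
     [[6, 0, 8, 3, 7, 4, 5, 2]])
    (by decide +kernel))

theorem fullBip_2_4_7 : FullBip 2 4 7 :=
  fullBip_of_intervalW (full_intervalW (L := develop (rotate 11 7) 7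
     [[4, 8, 0, 9, 5, 7, 3, 10]])
    (by decide +kernel))

theorem fullBip_2_4_9 : FullBip 2 4 9 :=
  fullBip_of_intervalW (full_intervalW (L := develop (rotate 13 9) 9
     [[10, 0, 12, 7, 9, 1, 11, 8]])
    (by decide +kernel))

theorem fullBip_4_6_5 : FullBip 4 6 5 :=
  fullBip_of_intervalW (full_intervalW (L := develop (rotate 11 5) 5
     [[0, 7, 2, 8, 4, 10, 3, 5], [0, 9, 3, 6, 1, 10, 4, 5], [6, 4, 8, 1, 9, 0, 7, 2]])
    (by decide +kernel))

theorem fullBip_4_6_7 : FullBip 4 6 7 :=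
  fullBip_of_intervalW (full_intervalW (L := develop (rotate 13 7) 7
     [[10, 1, 7, 2, 12, 4, 8, 0], [3, 11, 2, 9, 5, 12, 4, 7], [2, 8, 0, 11, 3, 9, 4, 10]])
    (by decide +kernel))

theorem fullBip_8_5_5 : FullBip 8 5 5 :=
  fullBip_of_intervalW (full_intervalW (L := develop (rotate 10 5) 5
     [[3, 6, 1, 7, 4, 8, 2, 9], [1, 7, 4, 5, 3, 8, 2, 6], [3, 9, 2, 5, 0, 6, 4, 7],
      [6, 0, 9, 2, 8, 4, 5, 3], [5, 4, 7, 3, 8, 0, 9, 2]])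
    (by decide +kernel))

theorem fullBip_8_5_7 : FullBip 8 5 7 :=
  fullBip_of_intervalW (full_intervalW (L := develop (rotate 12 7) 7
     [[4, 8, 1, 10, 3, 11, 5, 7], [11, 6, 9, 5, 10, 1, 8, 4], [5, 7, 3, 9, 6, 10, 0, 11],
      [6, 7, 2, 9, 0, 8, 3, 10], [7, 1, 9, 2, 11, 6, 8, 0]])
    (by decide +kernel))

theorem fullBip_8_7_7 : FullBip 8 7 7 :=
  fullBip_of_intervalW (full_intervalW (L := develop (rotate 14 7) 7
     [[4, 8, 1, 10, 6, 13, 0, 7], [11, 4, 12, 0, 9, 6, 10, 5], [9, 5, 8, 2, 13, 3, 11, 0],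
      [11, 6, 7, 4, 12, 2, 10, 3], [8, 6, 12, 0, 9, 3, 13, 1], [10, 2, 7, 3, 12, 6, 13, 0],
      [4, 7, 1, 11, 2, 8, 0, 9]])
    (by decide +kernel))

theorem fullBip_1_4_6 : FullBip 1 4 6 :=
  fullBip_of_intervalW (full_intervalW (L :=
     [[1, 6, 3, 7, 0, 9, 5, 8], [0, 6, 2, 7, 4, 9, 3, 8], [5, 6, 4, 8, 2, 9, 1, 7]])
    (by decide +kernel))

theorem fullBip_1_4_8 : FullBip 1 4 8 :=
  fullBip_of_intervalW (full_intervalW (L :=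
     [[2, 8, 4, 9, 3, 10, 6, 11], [2, 9, 5, 11, 0, 8, 1, 10], [6, 9, 0, 10, 7, 11, 3, 8],
      [5, 10, 4, 11, 1, 9, 7, 8]])
    (by decide +kernel))

theorem fullBip_1_4_10 : FullBip 1 4 10 :=
  fullBip_of_intervalW (full_intervalW (L :=
     [[2, 10, 7, 12, 5, 11, 3, 13], [0, 11, 4, 13, 6, 10, 1, 12],
      [5, 13, 8, 11, 9, 12, 3, 10], [0, 10, 4, 12, 6, 11, 1, 13], [2, 11, 7, 13, 9, 10, 8, 12]])
    (by decide +kernel))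

theorem fullBip_2_6_6 : FullBip 2 6 6 :=
  fullBip_of_intervalW (full_intervalW (L :=
     [[1, 8, 3, 6, 4, 11, 2, 7], [2, 10, 4, 9, 1, 11, 0, 8], [5, 7, 0, 6, 2, 10, 1, 9],
      [2, 11, 3, 7, 1, 8, 4, 6], [4, 10, 0, 7, 5, 11, 3, 9], [5, 8, 2, 9, 0, 6, 1, 11],
      [5, 10, 0, 11, 4, 7, 3, 6], [5, 9, 2, 7, 4, 8, 3, 10], [3, 10, 1, 6, 5, 8, 0, 9]])
    (by decide +kernel))

theorem fullMulti_1_2_9 : FullMulti 1 2 9 :=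
  fullMulti_of_residueW (full_residueW (L := develop (rotate 9 9) 9
     [[3, 2, 7, 0, 6, 4, 5, 8]])
    (by decide +kernel))

theorem fullMulti_1_1_17 : FullMulti 1 1 17 :=
  fullMulti_of_residueW (full_residueW (L := develop (rotate 17 17) 17
     [[14, 11, 3, 7, 5, 12, 1, 13]])
    (by decide +kernel))

theorem fullMulti_1_4_13 : FullMulti 1 4 13 :=
  fullMulti_of_residueW (full_residueW (L := develop (rotate 13 13) 13
     [[10, 12, 4, 1, 2, 11, 5, 3], [12, 4, 0, 11, 8, 7, 6, 1], [2, 6, 3, 10, 0, 4, 9, 8]])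
    (by decide +kernel))

theorem fullMulti_1_8_11 : FullMulti 1 8 11 :=
  fullMulti_of_residueW (full_residueW (L := develop (rotate 11 11) 11
     [[7, 0, 2, 5, 10, 4, 3, 8], [1, 3, 10, 2, 5, 9, 8, 0], [4, 7, 9, 5, 3, 8, 1, 10],
      [3, 6, 5, 4, 9, 10, 1, 8], [8, 1, 10, 7, 9, 3, 4, 0]])
    (by decide +kernel))

theorem fullMulti_1_8_15 : FullMulti 1 8 15 :=
  fullMulti_of_residueW (full_residueW (L := develop (rotate 15 15) 15
     [[9, 5, 0, 13, 4, 3, 6, 14], [13, 2, 11, 8, 9, 12, 10, 6], [1, 9, 3, 13, 12, 10, 7, 11],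
      [14, 13, 11, 3, 9, 12, 10, 0], [1, 4, 13, 9, 14, 6, 8, 7], [6, 9, 13, 5, 0, 11, 2, 10],
      [4, 9, 8, 10, 11, 3, 1, 13]])
    (by decide +kernel))

theorem fullMulti_1_8_10 : FullMulti 1 8 10 :=
  fullMulti_of_residueW (full_residueW (L := develop (rotate 10 9) 9
     [[9, 6, 8, 5, 4, 0, 2, 3], [2, 8, 3, 4, 6, 1, 9, 0], [3, 2, 8, 0, 6, 1, 7, 5],
      [0, 5, 2, 9, 3, 4, 8, 1], [4, 8, 2, 9, 5, 7, 6, 0]])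
    (by decide +kernel))

theorem fullMulti_1_4_12 : FullMulti 1 4 12 :=
  fullMulti_of_residueW (full_residueW (L := develop (rotate 12 11) 11
     [[1, 3, 2, 10, 5, 11, 6, 7], [10, 5, 1, 8, 6, 3, 7, 11], [6, 7, 10, 5, 3, 0, 1, 8]])
    (by decide +kernel))

theorem fullMulti_1_8_14 : FullMulti 1 8 14 :=
  fullMulti_of_residueW (full_residueW (L := develop (rotate 14 13) 13
     [[10, 12, 6, 2, 7, 13, 0, 3], [10, 5, 3, 4, 8, 7, 2, 12], [6, 3, 7, 13, 12, 11, 4, 8],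
      [9, 4, 11, 10, 7, 8, 12, 2], [7, 5, 13, 8, 0, 3, 11, 12], [10, 6, 8, 2, 0, 13, 12, 3],
      [12, 11, 8, 9, 1, 5, 3, 6]])
    (by decide +kernel))

theorem fullMulti_1_2_16 : FullMulti 1 2 16 :=
  fullMulti_of_residueW (full_residueW (L := develop (rotate 16 15) 15
     [[1, 13, 2, 8, 3, 5, 4, 11], [11, 3, 12, 10, 13, 15, 1, 0]])
    (by decide +kernel))

theorem fullMulti_1_4_20 : FullMulti 1 4 20 :=
  fullMulti_of_residueW (full_residueW (L := develop (rotate 20 19) 19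
     [[19, 4, 6, 15, 8, 3, 14, 11], [8, 13, 12, 10, 4, 0, 3, 18],
      [13, 6, 5, 16, 3, 2, 14, 11], [7, 12, 3, 11, 19, 6, 0, 8], [10, 16, 12, 5, 15, 1, 3, 6]])
    (by decide +kernel))

theorem fullMulti_1_2_24 : FullMulti 1 2 24 :=
  fullMulti_of_residueW (full_residueW (L := develop (rotate 24 23) 23
     [[12, 17, 23, 7, 4, 20, 19, 2], [1, 6, 14, 12, 16, 7, 18, 8],
      [5, 11, 9, 21, 6, 10, 13, 14]])
    (by decide +kernel))

theorem fullMulti_2_1_5 : FullMulti 2 1 5 :=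
  fullMulti_of_residueW (full_residueW (L := develop (rotate 5 5) 5
     [[2, 8, 9, 7, 3, 6, 4, 1]])
    (by decide +kernel))

theorem fullMulti_2_1_8 : FullMulti 2 1 8 :=
  fullMulti_of_residueW (full_residueW (L := develop (rotate 8 7) 7
     [[1, 10, 15, 6, 2, 0, 7, 11], [1, 12, 5, 11, 9, 10, 14, 2]])
    (by decide +kernel))

theorem fullMulti_2_1_12 : FullMulti 2 1 12 :=
  fullMulti_of_residueW (full_residueW (L := develop (rotate 12 11) 11
     [[1, 6, 16, 22, 11, 0, 17, 21], [15, 14, 7, 9, 8, 19, 3, 0],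
      [23, 21, 18, 20, 7, 15, 1, 8]])
    (by decide +kernel))

theorem fullMulti_2_2_6 : FullMulti 2 2 6 :=
  fullMulti_of_residueW (full_residueW (L := develop (rotate 6 5) 5
     [[1, 3, 4, 7, 0, 5, 6, 10], [4, 2, 7, 10, 11, 1, 6, 3], [11, 2, 9, 5, 1, 10, 8, 7]])
    (by decide +kernel))

theorem fullMulti_2_2_7 : FullMulti 2 2 7 :=
  fullMulti_of_residueW (full_residueW (L := develop (rotate 7 7) 7
     [[2, 6, 8, 0, 11, 13, 1, 7], [13, 7, 3, 4, 12, 9, 6, 8], [6, 2, 0, 13, 12, 8, 5, 4]])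
    (by decide +kernel))

theorem fullMulti_3_4_5 : FullMulti 3 4 5 :=
  fullMulti_of_residueW (full_residueW (L := develop (rotate 15 15) 15
     [[12, 14, 6, 7, 1, 5, 13, 10], [6, 12, 13, 1, 2, 4, 8, 5], [13, 11, 5, 9, 1, 12, 4, 10]])
    (by decide +kernel))

theorem fullMulti_3_4_4 : FullMulti 3 4 4 :=
  fullMulti_of_residueW (full_residueW (L := develop (fun x => (x + 4) % 12) 3
     [[0, 6, 4, 2, 5, 3, 8, 9], [10, 7, 2, 3, 9, 11, 8, 5], [4, 5, 6, 8, 7, 0, 1, 11],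
      [0, 5, 6, 7, 1, 8, 10, 9], [11, 8, 7, 5, 10, 4, 3, 6], [4, 1, 10, 5, 11, 9, 3, 6],
      [9, 8, 2, 3, 0, 5, 7, 6], [8, 11, 6, 9, 7, 10, 0, 2], [7, 0, 11, 6, 1, 2, 4, 9]])
    (by decide +kernel))

theorem fullMulti_4_1_3 : FullMulti 4 1 3 :=
  fullMulti_of_residueW (full_residueW (L := develop (rotate 3 3) 3
     [[3, 11, 4, 5, 6, 10, 2, 1], [0, 7, 8, 10, 11, 1, 6, 4]])
    (by decide +kernel))

theorem fullMulti_3_8_3 : FullMulti 3 8 3 :=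
  fullMulti_of_residueW (full_residueW (L :=
     [[2, 7, 5, 1, 8, 6, 4, 3], [0, 2, 4, 8, 1, 6, 5, 7], [0, 4, 3, 7, 8, 6, 1, 2],
      [1, 2, 6, 5, 0, 7, 8, 3], [0, 8, 1, 3, 4, 5, 7, 2], [2, 6, 4, 8, 3, 1, 5, 7],
      [0, 7, 2, 3, 4, 6, 8, 1], [1, 5, 0, 2, 3, 4, 6, 8], [0, 2, 7, 6, 4, 5, 3, 1],
      [1, 8, 4, 6, 7, 3, 2, 0], [1, 8, 6, 5, 0, 4, 3, 2], [5, 6, 7, 0, 4, 2, 1, 3],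
      [0, 2, 6, 7, 8, 1, 5, 4], [7, 8, 0, 2, 6, 1, 3, 5], [0, 5, 1, 6, 7, 8, 3, 4],
      [1, 5, 3, 7, 0, 8, 4, 2], [0, 5, 3, 4, 8, 7, 6, 1], [3, 5, 1, 2, 4, 6, 8, 7],
      [3, 8, 0, 5, 1, 6, 4, 2], [0, 8, 6, 7, 5, 3, 2, 4], [6, 7, 0, 1, 3, 5, 4, 2],
      [6, 8, 3, 7, 0, 5, 4, 2], [0, 5, 4, 8, 3, 7, 2, 1], [0, 8, 3, 7, 2, 6, 5, 4],
      [5, 6, 1, 3, 7, 0, 8, 4], [0, 1, 2, 6, 5, 7, 8, 4], [2, 7, 5, 6, 1, 0, 8, 3]])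
    (by decide +kernel))

end Base

/-! ### Two decompositions into cycles and paths -/

theorem dec_sum_cycleW : ∀ {L : List (List ℕ)}, (∀ c ∈ L, isCycle c) →
    Dec (L.map cycleW).sum 0 L.length
  | [], _ => Dec.zero
  | c :: L, hL => by
    simp only [isCycle, List.mem_cons, Bool.and_eq_true, beq_iff_eq, decide_eq_true_eq,
      forall_eq_or_imp] at hL
    exact Dec.cycle c hL.1.1 hL.1.2 (dec_sum_cycleW (by simpa [isCycle] using hL.2))

theorem dec_sum_trailW : ∀ {L : List (List ℕ)}, (∀ c ∈ L, c.length = 9 ∧ c.Nodup) →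
    Dec (L.map trailW).sum L.length 0
  | [], _ => Dec.zero
  | c :: L, hL => Dec.path c (hL c (by simp)).1 (hL c (by simp)).2
      (dec_sum_trailW fun d hd => hL d (by simp [hd]))

/-- `K_8(2)` is the union of seven `8`-cycles. It has too few vertices to contain a path with `8`
edges, but its blow-ups are full. -/
theorem dec_residueW_eight : Dec (residueW 8 1 2) 0 7 := by
  let L : List (List ℕ) := orbit (rotate 8 7) 7 [0, 1, 2, 5, 3, 6, 4, 7]
  have hL : L.all isCycle := by decide +kernel
  have hW : weightOK 8 (residueW 8 1 2) (L.flatMap cycleEdges) := by decide +kernel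
  refine (dec_sum_cycleW (List.all_eq_true.1 hL)).cast ?_ rfl rfl
  funext x y
  rw [← edgeCount_eq_of_weightOK hW (residueW_symm 8 1 2) (fun _ _ => residueW_ne_zero)
    (fun _ _ => ite_lt_of_lt (by norm_num)), edgeCount_flatMap x y (edgeCount_cycleEdges x y)]

/-- `K_16` is the union of `8` paths and `7` cycles with `8` edges, and it can be decomposed with
any larger number of paths. The two parts `P` and `C` are named since they are blown up in different
ways. The `8` paths are the images of one path under the even rotations. -/
theorem exists_dec_residueW_sixteen : ∃ P C : ℕ → ℕ → ℕ, residueW 16 1 1 = P + C ∧ Dec P 8 0 ∧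
    Dec C 0 7 ∧ HasRange (P + C) 8 15 := by
  let p : List ℕ := [7, 0, 15, 10, 14, 12, 5, 11, 8]
  let c : List ℕ := [0, 1, 6, 14, 8, 9, 11, 13]
  let R : List (List ℕ) := orbit (fun x => (x + 2) % 16) 7 (p.map fun x => (x + 2) % 16)
  let L : List (List ℕ) := [[10, 11, 7, 12, 9, 14, 15, 2], [2, 3, 7, 10, 0, 6, 12, 13],
    [11, 15, 4, 12, 2, 8, 5, 3], [7, 9, 5, 10, 4, 1, 13, 15], [0, 11, 14, 4, 5, 1, 3, 8],
    [5, 7, 6, 3, 15, 1, 9, 13]]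
  have hR : ∀ d ∈ R, d.length = 9 ∧ d.Nodup := by decide +kernel
  have hL : ∀ d ∈ L, isCycle d := by decide +kernel
  have hp : L.all isCycle ∧ pairsOK L := by decide +kernel
  have hW : weightOK 16 (residueW 16 1 1)
    ((p :: R).flatMap trailEdges ++ (c :: L).flatMap cycleEdges) := by decide +kernel
  have dp : Dec (trailW p) 1 0 := Dec.of_path rfl (by decide)
  have dc : Dec (cycleW c) 0 1 := Dec.of_cycle rfl (by decide)
  have dpc : Dec (trailW p + cycleW c) 2 0 :=
    dec_trade_path rfl (by decide) rfl (by decide) (by decide) (by decide)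
  have dR : Dec (R.map trailW).sum 7 0 := dec_sum_trailW hR
  have dL : ∀ k ≤ 3, Dec (L.map cycleW).sum (2 * k) (6 - 2 * k) := fun k hk =>
    (pairs_of_pairsOK hL hp.2).dec (fun w hw => by
      obtain ⟨d, hd, rfl⟩ := List.mem_map.1 hw
      exact dec_of_isCycle (hL d hd)) k (by
        rw [List.length_map]
        exact Nat.mul_le_mul_left 2 hk)
  refine ⟨trailW p + (R.map trailW).sum, cycleW c + (L.map cycleW).sum, ?_, dp.add dR,
    dc.add (dL 0 (by omega)), ?_⟩
  · funext x y
    rw [← edgeCount_eq_of_weightOK hW (residueW_symm 16 1 1) (fun _ _ => residueW_ne_zero)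
      (fun _ _ => ite_lt_of_lt (by norm_num)), edgeCount_append,
      edgeCount_flatMap x y (edgeCount_trailEdges x y),
      edgeCount_flatMap x y (edgeCount_cycleEdges x y)]
    simp only [List.map_cons, List.sum_cons, Pi.add_apply]
  · intro a b hab ha
    obtain ⟨k, hk⟩ : ∃ k, a = 8 + 2 * k ∨ a = 9 + 2 * k := ⟨(a - 8) / 2, by omega⟩
    -- paths beyond the first `8` come from pairs of cycles; for an odd number of them the cycle `c`
    -- is traded with the path `p`
    rcases hk with rfl | rfl
    · refine (((dp.add dR).add dc).add (dL k (by omega))).cast ?_ (by omega) (by omega)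
      abel
    · refine ((dpc.add dR).add (dL k (by omega))).cast ?_ (by omega) (by omega)
      abel

/-! ### Blowing up vertices -/

section Blow

variable {U V T : Type*}

/-- The weight of the multigraph obtained by replacing each vertex by a copy of `T`, and each edge
by all edges between the two copies. -/
def blow (T : Type*) (W : U → U → ℕ) (x y : U × T) : ℕ :=
  W x.1 y.1

theorem blow_add (W W' : U → U → ℕ) : blow T (W + W') = blow T W + blow T W' := rfl

theorem blow_zero : blow T (0 : U → U → ℕ) = 0 := rfl

theorem exists_eq_of_length_eight {c : List U} (h : c.length = 8) :
    ∃ v₀ v₁ v₂ v₃ v₄ v₅ v₆ v₇, c = [v₀, v₁, v₂, v₃, v₄, v₅, v₆, v₇] := by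
  match c, h with
  | [v₀, v₁, v₂, v₃, v₄, v₅, v₆, v₇], _ => exact ⟨_, _, _, _, _, _, _, _, rfl⟩

theorem exists_eq_of_length_nine {c : List U} (h : c.length = 9) :
    ∃ v₀ v₁ v₂ v₃ v₄ v₅ v₆ v₇ v₈, c = [v₀, v₁, v₂, v₃, v₄, v₅, v₆, v₇, v₈] := by
  match c, h with
  | [v₀, v₁, v₂, v₃, v₄, v₅, v₆, v₇, v₈], _ => exact ⟨_, _, _, _, _, _, _, _, _, rfl⟩

/-- The vertices of a list at even places get the label `a`, the other ones the label `b`. -/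
def alternate (a b : T) : List U → List (U × T)
  | [] => []
  | v :: t => (v, a) :: alternate b a t

theorem mem_of_mem_alternate {l : List U} {a b : T} {x : U × T} (h : x ∈ alternate a b l) :
    x.1 ∈ l := by
  induction l generalizing a b with
  | nil => simp [alternate] at h
  | cons v t ih =>
    rcases List.mem_cons.1 h with rfl | h
    · simp
    · exact List.mem_cons_of_mem _ (ih h)

theorem nodup_alternate {l : List U} (h : l.Nodup) (a b : T) : (alternate a b l).Nodup := by
  induction l generalizing a b with
  | nil => exact List.nodup_nil
  | cons v t ih =>
    exact List.nodup_cons.2 ⟨fun hv => (List.nodup_cons.1 h).1 (mem_of_mem_alternate hv),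
      ih (List.nodup_cons.1 h).2 b a⟩

theorem length_alternate (l : List U) (a b : T) : (alternate a b l).length = l.length := by
  induction l generalizing a b with
  | nil => rfl
  | cons v t ih => simp [alternate, ih]

variable [DecidableEq U] [DecidableEq V] [DecidableEq T]

/-- An edge is blown up into all the edges between two fibres. -/
theorem sum_sum_edgeW [Fintype T] {v w : U} (h : v ≠ w) :
    ∑ a : T, ∑ b : T, edgeW (v, a) (w, b) = blow T (edgeW v w) := by
  funext ⟨x, i⟩ ⟨y, j⟩
  simp only [Finset.sum_apply, blow, edgeW, Prod.mk.injEq]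
  by_cases h₁ : v = x ∧ w = y
  · obtain ⟨rfl, rfl⟩ := h₁
    simp [h, h.symm, ite_and]
  · by_cases h₂ : v = y ∧ w = x
    · obtain ⟨rfl, rfl⟩ := h₂
      simp [h, h.symm, ite_and]
    · rw [if_neg (by tauto)]
      refine Finset.sum_eq_zero fun a _ => Finset.sum_eq_zero fun b _ => if_neg ?_
      tauto

theorem sum_sum_edgeW' [Fintype T] {v w : U} (h : v ≠ w) :
    ∑ a : T, ∑ b : T, edgeW (v, b) (w, a) = blow T (edgeW v w) := by
  rw [Finset.sum_comm]
  exact sum_sum_edgeW h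

theorem sum_sum_cycleW_alternate [Fintype T] {c : List U} (hc : c.length = 8) (hn : c.Nodup) :
    ∑ a : T, ∑ b : T, cycleW (alternate a b c) = blow T (cycleW c) := by
  obtain ⟨v₀, v₁, v₂, v₃, v₄, v₅, v₆, v₇, rfl⟩ := exists_eq_of_length_eight hc
  simp only [List.nodup_cons, List.mem_cons, not_or] at hn
  simp only [alternate, cycleW_cons, List.cons_append, List.nil_append, trailW_cons_cons,
    trailW_singleton, add_zero, Finset.sum_add_distrib, blow_add]
  rw [sum_sum_edgeW, sum_sum_edgeW', sum_sum_edgeW, sum_sum_edgeW', sum_sum_edgeW, sum_sum_edgeW',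
    sum_sum_edgeW, sum_sum_edgeW']
  all_goals tauto

theorem sum_sum_trailW_alternate [Fintype T] {c : List U} (hc : c.length = 9) (hn : c.Nodup) :
    ∑ a : T, ∑ b : T, trailW (alternate a b c) = blow T (trailW c) := by
  obtain ⟨v₀, v₁, v₂, v₃, v₄, v₅, v₆, v₇, v₈, rfl⟩ := exists_eq_of_length_nine hc
  simp only [List.nodup_cons, List.mem_cons, not_or] at hn
  simp only [alternate, trailW_cons_cons,
    trailW_singleton, add_zero, Finset.sum_add_distrib, blow_add]
  rw [sum_sum_edgeW, sum_sum_edgeW', sum_sum_edgeW, sum_sum_edgeW', sum_sum_edgeW, sum_sum_edgeW',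
    sum_sum_edgeW, sum_sum_edgeW']
  all_goals tauto

theorem pairs_map {ι : Type*} {f : ι → V → V → ℕ}
    (hf : ∀ i j, i ≠ j → Dec (f i + f j) 2 0) : ∀ {L : List ι}, L.Nodup → Pairs (L.map f)
  | [], _ => trivial
  | [_], _ => trivial
  | i :: j :: L, h => by
    simp only [List.nodup_cons, List.mem_cons, not_or] at h
    exact ⟨hf i j h.1.1, pairs_map hf h.2.2⟩

/-- The blow-up of an `8`-cycle is full: it is the union of the cycles with labels alternating
between `a` and `b`, and those with the same `a` share a vertex at which edges can be exchanged. -/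
theorem fullWith_blow_cycleW [Fintype T] (hT : 3 ≤ Fintype.card T) {c : List U}
    (hc : c.length = 8) (hn : c.Nodup) :
    FullWith (blow T (cycleW c)) (Fintype.card T * Fintype.card T) := by
  rw [← sum_sum_cycleW_alternate hc hn]
  refine FullWith.sum Finset.univ fun a _ => ?_
  have hlen : ∀ b : T, (alternate a b c).length = 8 := fun b => by rw [length_alternate, hc]
  have hnd : ∀ b : T, (alternate a b c).Nodup := fun b => nodup_alternate hn a b
  obtain ⟨v₀, v₁, v₂, v₃, v₄, v₅, v₆, v₇, rfl⟩ := exists_eq_of_length_eight hc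
  have hmem : ∀ b b' : T, b ≠ b' →
      (v₁, b) ∉ alternate a b' [v₀, v₁, v₂, v₃, v₄, v₅, v₆, v₇] := by
    intro b b' hb
    simp only [List.nodup_cons, List.mem_cons, not_or] at hn
    simp only [alternate, List.mem_cons, Prod.mk.injEq, not_or]
    tauto
  have h₂ : ∀ b b' : T, b ≠ b' → Dec (cycleW (alternate a b [v₀, v₁, v₂, v₃, v₄, v₅, v₆, v₇]) +
      cycleW (alternate a b' [v₀, v₁, v₂, v₃, v₄, v₅, v₆, v₇])) 2 0 := fun b b' hb =>
    dec_trade_pair (hlen b) (hnd b) (hlen b') (hnd b') (hmem b' b hb.symm) (hmem b b' hb)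
  obtain ⟨L, hL, hL'⟩ : ∃ L : List T, L.Nodup ∧ L.toFinset = Finset.univ :=
    ⟨Finset.univ.toList, Finset.nodup_toList _, by simp⟩
  have hcard : L.length = Fintype.card T := by
    rw [← List.toFinset_card_of_nodup hL, hL', Finset.card_univ]
  rw [← hL', List.sum_toFinset _ hL, ← hcard]
  match L, hL, hcard with
  | b₁ :: b₂ :: b₃ :: L, hL, _ =>
    have hL₃ : L.Nodup := by
      simp only [List.nodup_cons] at hL
      exact hL.2.2.2
    have hpairs := pairs_map h₂ hL
    simp only [List.nodup_cons, List.mem_cons, not_or] at hL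
    have hlen₃ : (b₁ :: b₂ :: b₃ :: L).length = (L.map
        fun b => cycleW (alternate a b [v₀, v₁, v₂, v₃, v₄, v₅, v₆, v₇])).length + 3 := by simp
    rw [hlen₃]
    refine FullWith.of_pairs ?_ ?_ (pairs_map h₂ hL₃) hpairs
    · intro w hw
      have : w ∈ (b₁ :: b₂ :: b₃ :: L).map
          fun b => cycleW (alternate a b [v₀, v₁, v₂, v₃, v₄, v₅, v₆, v₇]) := hw
      obtain ⟨b, -, rfl⟩ := List.mem_map.1 this
      exact Dec.of_cycle (hlen b) (hnd b)
    · exact dec_trade_triple (hlen b₁) (hnd b₁) (hlen b₂) (hnd b₂) (hlen b₃) (hnd b₃)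
        (hmem _ _ (Ne.symm hL.1.1)) (hmem _ _ (Ne.symm hL.2.1.1)) (hmem _ _ hL.1.2.1)
  | [], _, h => simp at h; omega
  | [_], _, h => simp at h; omega
  | [_, _], _, h => simp at h; omega

theorem fullWith_blow [Fintype T] (hT : 3 ≤ Fintype.card T) {W : U → U → ℕ} {q : ℕ}
    (h : Dec W 0 q) : FullWith (blow T W) (q * (Fintype.card T * Fintype.card T)) := by
  generalize hp : 0 = p at h
  induction h with
  | zero => simpa [blow_zero] using FullWith.zero
  | path => omega
  | cycle l hl hn _ ih =>
    rw [blow_add, Nat.succ_mul, add_comm (_ * _)]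
    exact (fullWith_blow_cycleW hT hl hn).add (ih hp)

/-! ### Blowing up a path -/

/-- The blow-up of a path is the union of the paths with labels alternating between `a` and `b`. -/
theorem dec_blow_trailW_all [Fintype T] {c : List U} (hc : c.length = 9) (hn : c.Nodup) :
    Dec (blow T (trailW c)) (Fintype.card T * Fintype.card T) 0 := by
  rw [← sum_sum_trailW_alternate hc hn]
  refine (Dec.sum Finset.univ fun a _ => Dec.sum (p := 1) (q := 0) Finset.univ fun b _ =>
    Dec.of_path ?_ (nodup_alternate hn a b)).cast rfl (by simp) (by simp)
  rw [length_alternate, hc]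

/-- The representatives of the nonzero elements of `ZMod n` up to sign. -/
def halfSystem (n : ℕ) [NeZero n] : Finset (ZMod n) :=
  Finset.univ.filter fun d => d.val < (-d).val

section Odd

variable {n : ℕ} [NeZero n]

theorem two_mul_ne_zero_of_odd {n : ℕ} (hn : Odd n) {d : ZMod n} (hd : d ≠ 0) : d + d ≠ 0 := by
  intro h
  have h2 : IsUnit ((2 : ℕ) : ZMod n) := by
    rw [ZMod.isUnit_iff_coprime]
    exact Nat.coprime_two_left.2 hn
  have : ((2 : ℕ) : ZMod n) * d = ((2 : ℕ) : ZMod n) * 0 := by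
    push_cast
    rw [two_mul, h, mul_zero]
  exact hd (h2.mul_left_cancel this)

theorem mem_halfSystem_add (hn : Odd n) (z : ZMod n) :
    ((if z ∈ halfSystem n then 1 else 0) + if -z ∈ halfSystem n then 1 else 0) =
      if z = 0 then 0 else 1 := by
  simp only [halfSystem, Finset.mem_filter, Finset.mem_univ, true_and, neg_neg]
  by_cases hz : z = 0
  · simp [hz]
  · have : z.val ≠ (-z).val := fun h => two_mul_ne_zero_of_odd hn hz (by
      nth_rewrite 2 [ZMod.val_injective n h]
      simp)
    rw [if_neg hz]
    split_ifs <;> omega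

theorem ne_zero_of_mem_halfSystem {d : ZMod n} (hd : d ∈ halfSystem n) : d ≠ 0 := by
  rintro rfl
  simp [halfSystem] at hd

theorem two_mul_card_halfSystem (hn : Odd n) : 2 * (halfSystem n).card + 1 = n := by
  have h := Finset.sum_congr (rfl : (Finset.univ : Finset (ZMod n)) = Finset.univ)
    fun z _ => mem_halfSystem_add hn z
  have hneg : (∑ z : ZMod n, if -z ∈ halfSystem n then 1 else 0) =
      ∑ z : ZMod n, if z ∈ halfSystem n then 1 else 0 :=
    Equiv.sum_comp (Equiv.neg (ZMod n)) fun z => if z ∈ halfSystem n then 1 else 0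
  rw [Finset.sum_add_distrib, hneg] at h
  simp only [Finset.sum_ite_mem, Finset.univ_inter, Finset.sum_const, smul_eq_mul, mul_one] at h
  have h' : (∑ z : ZMod n, if z = 0 then 0 else 1) + 1 = n := by
    rw [← Finset.sum_erase_add _ _ (Finset.mem_univ (0 : ZMod n)),
      Finset.sum_congr rfl (g := fun _ => 1)
        (fun z hz => by rw [if_neg (Finset.ne_of_mem_erase hz)])]
    simp [ZMod.card]
    have := NeZero.one_le (n := n)
    omega
  omega

/-- The part of the blow-up that consists of the edges between different labels. -/
def offDiag (n : ℕ) (W : U → U → ℕ) (x y : U × ZMod n) : ℕ :=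
  if x.2 = y.2 then 0 else W x.1 y.1

theorem sum_edgeW_shift {v w : U} (hvw : v ≠ w) (e : ZMod n) (x y : U) (i j : ZMod n) :
    (∑ a : ZMod n, edgeW (v, a) (w, a + e)) (x, i) (y, j) =
      (if v = x ∧ w = y ∧ j - i = e then 1 else 0) +
        if v = y ∧ w = x ∧ i - j = e then 1 else 0 := by
  simp only [Finset.sum_apply, edgeW, Prod.mk.injEq]
  by_cases h₁ : v = x ∧ w = y
  · obtain ⟨rfl, rfl⟩ := h₁
    simp [hvw, ite_and, Finset.sum_ite_eq, add_comm, eq_comm]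
    congr 1
    exact propext ⟨fun h => by rw [h, add_sub_cancel_right], fun h => by rw [h, sub_add_cancel]⟩
  · by_cases h₂ : v = y ∧ w = x
    · obtain ⟨rfl, rfl⟩ := h₂
      simp [hvw, ite_and, Finset.sum_ite_eq, add_comm, eq_comm]
      congr 1
      exact propext ⟨fun h => by rw [h, add_sub_cancel_right], fun h => by rw [h, sub_add_cancel]⟩
    · rw [if_neg (by tauto), if_neg (by tauto)]
      refine Finset.sum_eq_zero fun a _ => if_neg ?_
      tauto

/-- The edges over `vw` between labels that differ by `±d`, with `d` in the half system, are the
edges between different labels. -/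
theorem sum_edgeW_halfSystem (hn : Odd n) {v w : U} (hvw : v ≠ w) :
    ∑ d ∈ halfSystem n, ((∑ a : ZMod n, edgeW (v, a) (w, a + d)) +
      ∑ a : ZMod n, edgeW (v, a) (w, a + -d)) = offDiag n (edgeW v w) := by
  funext ⟨x, i⟩ ⟨y, j⟩
  rw [Finset.sum_apply, Finset.sum_apply]
  simp only [Pi.add_apply (ι := U × ZMod n), sum_edgeW_shift hvw, offDiag]
  -- each nonzero `z` is `d` or `-d` for exactly one `d` in the half system
  have key : ∀ z : ZMod n, ∑ d ∈ halfSystem n, ((if z = d then 1 else 0) +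
      if z = -d then 1 else 0) = if z = 0 then 0 else 1 := by
    intro z
    rw [← mem_halfSystem_add hn, Finset.sum_add_distrib]
    simp only [← neg_eq_iff_eq_neg, Finset.sum_ite_eq]
  by_cases h₁ : v = x ∧ w = y
  · obtain ⟨rfl, rfl⟩ := h₁
    simpa [hvw, hvw.symm, edgeW, sub_eq_zero, eq_comm] using key (j - i)
  · by_cases h₂ : v = y ∧ w = x
    · obtain ⟨rfl, rfl⟩ := h₂
      simpa [hvw, hvw.symm, edgeW, sub_eq_zero, eq_comm] using key (i - j)
    · have h0 : edgeW v w x y = 0 := by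
        simp only [edgeW, ite_eq_right_iff, one_ne_zero, imp_false]
        tauto
      rw [h0, ite_self]
      refine Finset.sum_eq_zero fun d _ => ?_
      rw [if_neg (by tauto), if_neg (by tauto), if_neg (by tauto), if_neg (by tauto)]
      rfl

/-- The cycle that runs along the path `u₀u₁u₂u₃u₄` with the labels `a, a + d, a + 2d, a + d, a` and
returns with the labels `a - d, a - 2d, a - d`. -/
def lens (u₀ u₁ u₂ u₃ u₄ : U) (a d : ZMod n) : List (U × ZMod n) :=
  [(u₀, a), (u₁, a + d), (u₂, a + (d + d)), (u₃, a + d), (u₄, a), (u₃, a + -d),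
    (u₂, a + -(d + d)), (u₁, a + -d)]

theorem nodup_lens {U : Type*} {n : ℕ} (hn : Odd n) {u₀ u₁ u₂ u₃ u₄ : U}
    (hu : [u₀, u₁, u₂, u₃, u₄].Nodup) (a : ZMod n) {d : ZMod n} (hd : d ≠ 0) :
    (lens u₀ u₁ u₂ u₃ u₄ a d).Nodup := by
  have h₂ := two_mul_ne_zero_of_odd hn hd
  have h₄ := two_mul_ne_zero_of_odd hn h₂
  simp only [List.nodup_cons, List.mem_cons, not_or, List.not_mem_nil, not_false_iff] at hu
  simp only [lens, List.nodup_cons, List.mem_cons, not_or, Prod.mk.injEq, List.not_mem_nil,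
    add_right_inj, eq_neg_iff_add_eq_zero]
  tauto

theorem sum_edgeW_add (v w : U) (s t : ZMod n) :
    ∑ a : ZMod n, edgeW (v, a + s) (w, a + t) = ∑ a : ZMod n, edgeW (v, a) (w, a + (t - s)) := by
  refine Eq.trans (Finset.sum_congr rfl fun a _ => ?_)
    (Equiv.sum_comp (Equiv.addRight s) fun a => edgeW (v, a) (w, a + (t - s)))
  simp [add_assoc]

theorem sum_cycleW_lens (hn : Odd n) {u₀ u₁ u₂ u₃ u₄ : U} (hu : [u₀, u₁, u₂, u₃, u₄].Nodup) :
    ∑ d ∈ halfSystem n, ∑ a : ZMod n, cycleW (lens u₀ u₁ u₂ u₃ u₄ a d) =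
      offDiag n (edgeW u₀ u₁) + offDiag n (edgeW u₁ u₂) + offDiag n (edgeW u₂ u₃) +
        offDiag n (edgeW u₃ u₄) := by
  simp only [List.nodup_cons, List.mem_cons, not_or, List.not_mem_nil, not_false_iff] at hu
  rw [← sum_edgeW_halfSystem hn hu.1.1, ← sum_edgeW_halfSystem hn hu.2.1.1,
    ← sum_edgeW_halfSystem hn hu.2.2.1.1, ← sum_edgeW_halfSystem hn hu.2.2.2.1.1,
    ← Finset.sum_add_distrib, ← Finset.sum_add_distrib, ← Finset.sum_add_distrib]
  refine Finset.sum_congr rfl fun d _ => ?_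
  have e₂ := sum_edgeW_add u₁ u₂ d (d + d)
  have e₃ := sum_edgeW_add u₂ u₃ (d + d) d
  have e₄ := sum_edgeW_add u₃ u₄ d 0
  have e₅ := sum_edgeW_add u₃ u₄ (-d) 0
  have e₆ := sum_edgeW_add u₂ u₃ (-(d + d)) (-d)
  have e₇ := sum_edgeW_add u₁ u₂ (-d) (-(d + d))
  rw [show d + d - d = d by ring] at e₂
  rw [show d - (d + d) = -d by ring] at e₃
  rw [show 0 - d = -d by ring] at e₄
  rw [show 0 - -d = d by ring] at e₅
  rw [show -d - -(d + d) = d by ring] at e₆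
  rw [show -(d + d) - -d = -d by ring] at e₇
  simp only [add_zero] at e₄ e₅
  simp only [lens, cycleW_cons, List.cons_append, List.nil_append, trailW_cons_cons,
    trailW_singleton, add_zero, Finset.sum_add_distrib]
  simp only [edgeW_swap (u₄, _) (u₃, _), edgeW_swap (u₃, _) (u₂, _), edgeW_swap (u₂, _) (u₁, _),
    edgeW_swap (u₁, _) (u₀, _)]
  rw [e₂, e₃, e₄, e₅, e₆, e₇]
  abel

/-- The path in one of the layers of the blow-up. -/
def layer (c : List U) (a : ZMod n) : List (U × ZMod n) :=
  c.map fun v => (v, a)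

theorem sum_edgeW_layer {v w : U} (hvw : v ≠ w) :
    (∑ a : ZMod n, edgeW (v, a) (w, a)) + offDiag n (edgeW v w) = blow (ZMod n) (edgeW v w) := by
  funext ⟨x, i⟩ ⟨y, j⟩
  have h := sum_edgeW_shift hvw (0 : ZMod n) x y i j
  simp only [add_zero] at h
  rw [Pi.add_apply, Pi.add_apply, h]
  simp only [offDiag, blow, edgeW, sub_eq_zero]
  have hij : j = i ↔ i = j := eq_comm
  by_cases h₁ : i = j
  · subst h₁
    clear h
    by_cases h₂ : v = x ∧ w = y <;> by_cases h₃ : v = y ∧ w = x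
    · exact absurd (h₂.1.trans h₃.2.symm) hvw
    all_goals simp [h₂, h₃]
    · exact fun h h' => hvw (by rw [h₂.1, h₂.2, h])
    · exact fun h h' => hvw (by rw [h₃.1, h₃.2, h])
  · simp [h₁, hij]

/-- The blow-up of a path consists of its layers and of two families of cycles, one over each half
of the path. -/
theorem sum_layer_add_sum_lens (hn : Odd n) {v₀ v₁ v₂ v₃ v₄ v₅ v₆ v₇ v₈ : U}
    (hc : [v₀, v₁, v₂, v₃, v₄, v₅, v₆, v₇, v₈].Nodup) :
    (∑ a : ZMod n, trailW (layer [v₀, v₁, v₂, v₃, v₄, v₅, v₆, v₇, v₈] a)) +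
      ((∑ d ∈ halfSystem n, ∑ a : ZMod n, cycleW (lens v₀ v₁ v₂ v₃ v₄ a d)) +
        ∑ d ∈ halfSystem n, ∑ a : ZMod n, cycleW (lens v₄ v₅ v₆ v₇ v₈ a d)) =
      blow (ZMod n) (trailW [v₀, v₁, v₂, v₃, v₄, v₅, v₆, v₇, v₈]) := by
  have h₁ : [v₀, v₁, v₂, v₃, v₄].Nodup := (List.take_sublist 5 _).nodup hc
  have h₂ : [v₄, v₅, v₆, v₇, v₈].Nodup := (List.drop_sublist 4 _).nodup hc
  rw [sum_cycleW_lens hn h₁, sum_cycleW_lens hn h₂]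
  simp only [List.nodup_cons, List.mem_cons, not_or] at hc
  simp only [layer, List.map_cons, List.map_nil, trailW_cons_cons, trailW_singleton, add_zero,
    Finset.sum_add_distrib, blow_add]
  rw [← sum_edgeW_layer (v := v₀) (w := v₁) (by tauto),
    ← sum_edgeW_layer (v := v₁) (w := v₂) (by tauto),
    ← sum_edgeW_layer (v := v₂) (w := v₃) (by tauto),
    ← sum_edgeW_layer (v := v₃) (w := v₄) (by tauto),
    ← sum_edgeW_layer (v := v₄) (w := v₅) (by tauto),
    ← sum_edgeW_layer (v := v₅) (w := v₆) (by tauto),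
    ← sum_edgeW_layer (v := v₆) (w := v₇) (by tauto),
    ← sum_edgeW_layer (v := v₇) (w := v₈) (by tauto)]
  abel

theorem nodup_layer {U : Type*} {n : ℕ} {c : List U} (hc : c.Nodup) (a : ZMod n) :
    (layer c a).Nodup :=
  hc.map fun _ _ h => (Prod.mk.inj h).1

/-- The blow-up of a path decomposes with `n` paths, and also with `n + 1` paths. -/
theorem dec_blow_trailW (hn : Odd n) (hn₃ : 3 ≤ n) {c : List U} (hc : c.length = 9)
    (hnd : c.Nodup) : Dec (blow (ZMod n) (trailW c)) n (n * n - n) ∧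
      Dec (blow (ZMod n) (trailW c)) (n + 1) (n * n - n - 1) := by
  have hcard := two_mul_card_halfSystem hn
  have hlayer : ∀ a : ZMod n, (layer c a).length = 9 := fun a => by simp [layer, hc]
  obtain ⟨v₀, v₁, v₂, v₃, v₄, v₅, v₆, v₇, v₈, rfl⟩ := exists_eq_of_length_nine hc
  rw [← sum_layer_add_sum_lens hn hnd]
  have h₁ : [v₀, v₁, v₂, v₃, v₄].Nodup := (List.take_sublist 5 _).nodup hnd
  have h₂ : [v₄, v₅, v₆, v₇, v₈].Nodup := (List.drop_sublist 4 _).nodup hnd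
  have hmul : n * n - n = (halfSystem n).card * n + (halfSystem n).card * n := by
    rw [← Nat.sub_one_mul]
    nth_rewrite 1 [← hcard]
    rw [Nat.add_sub_cancel]
    ring
  have hcyc : ∀ {u₀ u₁ u₂ u₃ u₄ : U}, [u₀, u₁, u₂, u₃, u₄].Nodup → ∀ d ∈ halfSystem n,
      ∀ a : ZMod n, Dec (cycleW (lens u₀ u₁ u₂ u₃ u₄ a d)) 0 1 := fun hu d hd a =>
    Dec.of_cycle rfl (nodup_lens hn hu a (ne_zero_of_mem_halfSystem hd))
  have hsum : ∀ {u₀ u₁ u₂ u₃ u₄ : U}, [u₀, u₁, u₂, u₃, u₄].Nodup →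
      ∀ s ⊆ halfSystem n, Dec (∑ d ∈ s, ∑ a : ZMod n, cycleW (lens u₀ u₁ u₂ u₃ u₄ a d)) 0
        (s.card * n) := fun hu s hs =>
    (Dec.sum s fun d hd => Dec.sum (p := 0) (q := 1) Finset.univ fun a _ =>
      hcyc hu d (hs hd) a).cast rfl (by simp) (by simp [ZMod.card])
  have hpath : ∀ a : ZMod n, Dec (trailW (layer [v₀, v₁, v₂, v₃, v₄, v₅, v₆, v₇, v₈] a)) 1 0 :=
    fun a => Dec.of_path (hlayer a) (nodup_layer hnd a)
  constructor
  · refine ((Dec.sum Finset.univ fun a _ => hpath a).add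
      ((hsum h₁ _ subset_rfl).add (hsum h₂ _ subset_rfl))).cast rfl (by simp [ZMod.card]) ?_
    simp [hmul]
  · -- exchange an edge at `(v₁, 0)` between the layer `0` and the cycle with `a = -d`
    obtain ⟨d, hd⟩ : (halfSystem n).Nonempty := Finset.card_pos.1 (by omega)
    have hd0 := ne_zero_of_mem_halfSystem hd
    have trade : Dec (trailW (layer [v₀, v₁, v₂, v₃, v₄, v₅, v₆, v₇, v₈] (0 : ZMod n)) +
        cycleW (lens v₀ v₁ v₂ v₃ v₄ (-d) d)) 2 0 := by
      have hrot : (lens v₀ v₁ v₂ v₃ v₄ (-d) d).reverse.rotate 6 =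
          [(v₁, -d + d), (v₀, -d), (v₁, -d + -d), (v₂, -d + -(d + d)), (v₃, -d + -d), (v₄, -d),
            (v₃, -d + d), (v₂, -d + (d + d))] := rfl
      have hndl := nodup_lens hn h₁ (-d) hd0
      rw [← cycleW_reverse, ← cycleW_rotate _ 6, hrot]
      rw [← List.nodup_reverse, ← List.nodup_rotate (n := 6), hrot] at hndl
      have hl := hlayer 0
      have hln := nodup_layer (n := n) hnd 0
      simp only [layer, List.map_cons, List.map_nil] at hl hln ⊢
      rw [neg_add_cancel] at hndl ⊢
      refine dec_trade_path rfl hndl hl hln ?_ ?_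
      · simp only [List.nodup_cons, List.mem_cons, not_or] at hnd
        simp only [List.mem_cons, Prod.mk.injEq, not_or, List.not_mem_nil, not_false_iff]
        have : ¬ (0 : ZMod n) = -d := fun h => hd0 (by simpa using h.symm)
        tauto
      · simp only [List.mem_cons, Prod.mk.injEq, not_or, List.not_mem_nil, not_false_iff]
        have : ¬ -d = (0 : ZMod n) := fun h => hd0 (by simpa using h)
        tauto
    have hA := Finset.add_sum_erase Finset.univ
      (fun a : ZMod n => trailW (layer [v₀, v₁, v₂, v₃, v₄, v₅, v₆, v₇, v₈] a))
      (Finset.mem_univ (0 : ZMod n))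
    have hB := Finset.add_sum_erase (halfSystem n)
      (fun d => ∑ a : ZMod n, cycleW (lens v₀ v₁ v₂ v₃ v₄ a d)) hd
    have hC := Finset.add_sum_erase Finset.univ
      (fun a : ZMod n => cycleW (lens v₀ v₁ v₂ v₃ v₄ a d)) (Finset.mem_univ (-d))
    have dA : Dec (∑ a ∈ Finset.univ.erase (0 : ZMod n),
        trailW (layer [v₀, v₁, v₂, v₃, v₄, v₅, v₆, v₇, v₈] a)) (n - 1) 0 :=
      (Dec.sum _ fun a _ => hpath a).cast rfl (by simp [ZMod.card]) (by simp)
    have dB := hsum h₁ _ (Finset.erase_subset d (halfSystem n))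
    have dC : Dec (∑ a ∈ Finset.univ.erase (-d), cycleW (lens v₀ v₁ v₂ v₃ v₄ a d)) 0 (n - 1) :=
      (Dec.sum _ fun a _ => hcyc h₁ d hd a).cast rfl (by simp) (by simp [ZMod.card])
    rw [Finset.card_erase_of_mem hd] at dB
    rw [← hA, ← hB, ← hC]
    refine ((trade.add dA).add ((dC.add dB).add (hsum h₂ _ subset_rfl))).cast ?_ (by omega) ?_
    · abel
    · have : (halfSystem n).card * n = ((halfSystem n).card - 1) * n + n := by
        rw [← Nat.succ_mul]
        congr 1
        omega
      rw [hmul]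
      omega

end Odd

/-- The blow-up of `p ≥ 1` paths, together with a full multigraph that is large enough: each
blown-up path contributes `n` or `n * n` paths and the full multigraph nearly everything in between.
-/
theorem hasRange_blow_paths {n : ℕ} [NeZero n] (hn : Odd n) (hn₃ : 3 ≤ n)
    {F : U × ZMod n → U × ZMod n → ℕ} {N : ℕ} (hF : FullWith F N) (hN : n * n ≤ N)
    {P : U → U → ℕ} {p : ℕ} (hP : Dec P p 0) (hp : 1 ≤ p) :
    HasRange (F + blow (ZMod n) P) (p * n) (N + p * (n * n)) := by
  have hnn : n * 3 ≤ n * n := Nat.mul_le_mul_left n hn₃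
  generalize hq : 0 = q at hP
  induction hP with
  | zero => omega
  | cycle => omega
  | @path P p q l hl hnd hP ih =>
    subst hq
    obtain ⟨d₁, d₂⟩ := dec_blow_trailW (n := n) hn hn₃ hl hnd
    have d₃ := dec_blow_trailW_all (T := ZMod n) hl hnd
    rw [ZMod.card] at d₃
    rw [blow_add]
    intro a b hab ha
    rw [Nat.succ_mul] at ha
    rw [Nat.succ_mul] at hab
    rcases Nat.eq_zero_or_pos p with rfl | hp
    · rw [zero_mul, zero_add] at ha hab
      obtain ⟨-, -, hF⟩ := hF
      rw [add_left_comm]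
      have dP : ∀ {a' b'}, a' + b' = N → a' ≠ 1 → Dec (F + blow (ZMod n) P) a' b' :=
        fun h h' => ((hF _ _ h h').add (show Dec (blow (ZMod n) P) 0 0 by
          cases hP
          exact Dec.zero)).cast rfl rfl rfl
      -- for `a = n + 1` the full multigraph would have to contribute exactly one path
      by_cases c₁ : a = n + 1
      · exact (d₂.add (dP (a' := 0) (b' := N) (by omega) (by omega))).cast rfl (by omega) (by omega)
      · by_cases c₂ : a ≤ n + N
        · exact (d₁.add (dP (a' := a - n) (b' := N - (a - n)) (by omega) (by omega))).cast rfl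
            (by omega) (by omega)
        · exact (d₃.add (dP (a' := a - n * n) (b' := N - (a - n * n)) (by omega)
            (by omega))).cast rfl (by omega) (by omega)
    · have ih := ih hp rfl
      rw [add_left_comm]
      have hpn : p * n ≤ p * (n * n) := Nat.mul_le_mul_left p (by omega)
      by_cases c : a ≤ n + (N + p * (n * n))
      · exact (d₁.add (ih (a - n) (N + p * (n * n) - (a - n)) (by omega) (by omega))).cast rfl
          (by omega) (by omega)
      · exact (d₃.add (ih (a - n * n) (N + p * (n * n) - (a - n * n)) (by omega) (by omega))).cast
          rfl (by omega) (by omega)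

end Blow

/-! ### Complete bipartite multigraphs -/

/-- `K_{4,b}` is put together from copies of `K_{4,6}`, `K_{4,8}` and `K_{4,10}`. -/
theorem fullBip_one_four {b : ℕ} (h₂ : 2 ∣ b) (h₆ : 6 ≤ b) : FullBip 1 4 b := by
  induction b using Nat.strong_induction_on with
  | _ b ih =>
    by_cases h : 12 ≤ b
    · obtain ⟨c, rfl⟩ := Nat.exists_eq_add_of_le' (show 6 ≤ b by omega)
      exact (ih c (by omega) (by omega) (by omega)).add_right fullBip_1_4_6
    · obtain rfl | rfl | rfl : b = 6 ∨ b = 8 ∨ b = 10 := by omega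
      exacts [fullBip_1_4_6, fullBip_1_4_8, fullBip_1_4_10]

theorem fullBip_one {a b : ℕ} (ha : 4 ∣ a) (hb : 2 ∣ b) (ha₄ : 4 ≤ a) (hb₄ : 4 ≤ b)
    (hab : 9 ≤ a + b) : FullBip 1 a b := by
  by_cases h : b = 4
  · subst h
    exact (fullBip_one_four (by omega) (by omega)).symm
  · obtain ⟨k, rfl⟩ := ha
    rw [mul_comm]
    exact (fullBip_one_four hb (by omega)).mul_left k

theorem fullBip_two_even {a b : ℕ} (ha : 2 ∣ a) (hb : 2 ∣ b) (ha₆ : 6 ≤ a) (hb₆ : 6 ≤ b) :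
    FullBip 2 a b := by
  by_cases ha₄ : 4 ∣ a
  · exact (fullBip_one ha₄ hb (by omega) (by omega) (by omega)).mul_mult 2
  by_cases hb₄ : 4 ∣ b
  · exact (fullBip_one hb₄ ha (by omega) (by omega) (by omega)).symm.mul_mult 2
  obtain ⟨i, rfl⟩ : ∃ i, a = i * 4 + 6 := ⟨(a - 6) / 4, by omega⟩
  obtain ⟨j, rfl⟩ : ∃ j, b = j * 4 + 6 := ⟨(b - 6) / 4, by omega⟩
  refine FullBip.add_left (((fullBip_one_four hb hb₆).mul_left i).mul_mult 2) ?_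
  exact (((fullBip_one_four (by omega) le_rfl).symm.mul_right j).mul_mult 2).add_right
    fullBip_2_6_6

theorem fullBip_two_four {b : ℕ} (h₅ : 5 ≤ b) : FullBip 2 4 b := by
  induction b using Nat.strong_induction_on with
  | _ b ih =>
    by_cases h₂ : 2 ∣ b
    · exact (fullBip_one_four h₂ (by omega)).mul_mult 2
    by_cases h : 11 ≤ b
    · obtain ⟨c, rfl⟩ := Nat.exists_eq_add_of_le' (show 6 ≤ b by omega)
      exact (ih c (by omega) (by omega)).add_right (fullBip_1_4_6.mul_mult 2)
    · obtain rfl | rfl | rfl : b = 5 ∨ b = 7 ∨ b = 9 := by omega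
      exacts [fullBip_2_4_5, fullBip_2_4_7, fullBip_2_4_9]

theorem fullBip_two {a b : ℕ} (ha : 4 ∣ a) (hb₅ : 5 ≤ b) : FullBip 2 a b := by
  obtain ⟨k, rfl⟩ := ha
  rw [mul_comm]
  exact (fullBip_two_four hb₅).mul_left k

theorem fullBip_four {a b : ℕ} (ha : 2 ∣ a) (ha₆ : 6 ≤ a) (hb : 5 ≤ b) : FullBip 4 a b := by
  by_cases ha₄ : 4 ∣ a
  · exact (fullBip_two ha₄ hb).mul_mult 2
  by_cases hb₂ : 2 ∣ b
  · exact (fullBip_two_even ha hb₂ ha₆ (by omega)).mul_mult 2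
  obtain ⟨i, rfl⟩ : ∃ i, a = i * 4 + 6 := ⟨(a - 6) / 4, by omega⟩
  refine FullBip.add_left (((fullBip_two_four hb).mul_left i).mul_mult 2) ?_
  have h₆ : ∀ j, FullBip 4 6 (j * 4) := fun j =>
    ((fullBip_one_four (by omega) le_rfl).symm.mul_right j).mul_mult 4
  by_cases hb₁ : b % 4 = 1
  · obtain ⟨j, rfl⟩ : ∃ j, b = j * 4 + 5 := ⟨(b - 5) / 4, by omega⟩
    exact (h₆ j).add_right fullBip_4_6_5
  · obtain ⟨j, rfl⟩ : ∃ j, b = j * 4 + 7 := ⟨(b - 7) / 4, by omega⟩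
    exact (h₆ j).add_right fullBip_4_6_7

theorem fullBip_eight {a b : ℕ} (ha : 5 ≤ a) (hb : 5 ≤ b) : FullBip 8 a b := by
  by_cases ha₂ : 2 ∣ a
  · exact (fullBip_four ha₂ (by omega) hb).mul_mult 2
  by_cases hb₂ : 2 ∣ b
  · exact (fullBip_four hb₂ (by omega) ha).symm.mul_mult 2
  have red : ∀ {c : ℕ}, 5 ≤ c → FullBip 8 c 5 → FullBip 8 c 7 → FullBip 8 c b := by
    intro c hc h₅ h₇
    have h : ∀ j, FullBip 8 c (j * 4) := fun j =>
      ((fullBip_two_four hc).symm.mul_right j).mul_mult 4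
    by_cases hb₁ : b % 4 = 1
    · obtain ⟨j, rfl⟩ : ∃ j, b = j * 4 + 5 := ⟨(b - 5) / 4, by omega⟩
      exact (h j).add_right h₅
    · obtain ⟨j, rfl⟩ : ∃ j, b = j * 4 + 7 := ⟨(b - 7) / 4, by omega⟩
      exact (h j).add_right h₇
  have h : ∀ j, FullBip 8 (j * 4) b := fun j => ((fullBip_two_four hb).mul_left j).mul_mult 4
  by_cases ha₁ : a % 4 = 1
  · obtain ⟨i, rfl⟩ : ∃ i, a = i * 4 + 5 := ⟨(a - 5) / 4, by omega⟩
    exact (h i).add_left (red le_rfl fullBip_8_5_5 fullBip_8_5_7)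
  · obtain ⟨i, rfl⟩ : ∃ i, a = i * 4 + 7 := ⟨(a - 7) / 4, by omega⟩
    exact (h i).add_left (red (by omega) fullBip_8_5_7.symm fullBip_8_7_7)

/-! ### Parts of even size -/

theorem FullMulti.succ {n l m : ℕ} (h : FullMulti n l m) (hb : FullBip l (m * n) n) :
    FullMulti n l (m + 1) :=
  h.add (FullMulti.of_le_one n l le_rfl) (by rwa [one_mul])

theorem fullMulti_of_four_dvd {n m : ℕ} (hn : 4 ∣ n) (hmn : 9 ≤ m * n) : FullMulti n 1 m := by
  have step : ∀ m, 1 ≤ m → 9 ≤ m * n → FullMulti n 1 m → FullMulti n 1 (m + 1) := by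
    intro m hm hmn h
    have hn₄ : 4 ≤ n := Nat.le_of_dvd (Nat.pos_of_ne_zero (by rintro rfl; simp at hmn)) hn
    have : n ≤ m * n := Nat.le_mul_of_pos_left n hm
    exact h.succ (fullBip_one (hn.mul_left m) (by omega) (by omega) hn₄ (by omega))
  have hn₀ : n ≠ 0 := by
    rintro rfl
    simp at hmn
  by_cases h₄ : n = 4
  · subst h₄
    obtain ⟨k, rfl⟩ := Nat.exists_eq_add_of_le' (show 3 ≤ m by omega)
    clear hmn
    induction k with
    | zero => exact fullMulti_4_1_3
    | succ k ih =>
      rw [show k + 1 + 3 = (k + 3) + 1 by ring]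
      exact step _ (by omega) (by omega) ih
  · obtain ⟨k, rfl⟩ := Nat.exists_eq_add_of_le' (show 1 ≤ m by
      rcases m.eq_zero_or_pos with rfl | h
      · simp at hmn
      · exact h)
    clear hmn
    induction k with
    | zero => exact FullMulti.of_le_one n 1 le_rfl
    | succ k ih =>
      have : n ≤ (k + 1) * n := Nat.le_mul_of_pos_left n (by omega)
      exact ih.succ (fullBip_one (hn.mul_left _) (by omega) (by omega) (by omega) (by omega))

/-- `K_4` is the union of three paths with two edges. -/
theorem multiW_four (n l : ℕ) {w x y z : ℕ} (h : [w, x, y, z].Nodup) :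
    multiW n l {w, x, y, z} =
      bipW l ({w} ×ˢ Finset.range n) ({x, y} ×ˢ Finset.range n) +
      bipW l ({z} ×ˢ Finset.range n) ({w, x} ×ˢ Finset.range n) +
      bipW l ({y} ×ˢ Finset.range n) ({x, z} ×ˢ Finset.range n) := by
  simp only [List.nodup_cons, List.mem_cons, List.not_mem_nil, or_false, not_or] at h
  obtain ⟨⟨wx, wy, wz⟩, ⟨xy, xz⟩, yz, -⟩ := h
  funext ⟨i, a⟩ ⟨j, b⟩
  simp only [multiW, bipW, Finset.mem_insert, Finset.mem_singleton, Pi.add_apply,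
    Finset.mem_product, Finset.mem_range]
  by_cases ha : a < n <;> by_cases hb : b < n <;> simp only [ha, hb, true_and, and_true, and_false,
    false_and, or_false, if_false, add_zero]
  have hi : i = w ∨ i = x ∨ i = y ∨ i = z ∨ (i ≠ w ∧ i ≠ x ∧ i ≠ y ∧ i ≠ z) := by tauto
  have hj : j = w ∨ j = x ∨ j = y ∨ j = z ∨ (j ≠ w ∧ j ≠ x ∧ j ≠ y ∧ j ≠ z) := by tauto
  have wx' := Ne.symm wx
  have wy' := Ne.symm wy
  have wz' := Ne.symm wz
  have xy' := Ne.symm xy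
  have xz' := Ne.symm xz
  have yz' := Ne.symm yz
  rcases hi with rfl | rfl | rfl | rfl | ⟨i₁, i₂, i₃, i₄⟩ <;>
    rcases hj with rfl | rfl | rfl | rfl | ⟨j₁, j₂, j₃, j₄⟩ <;>
    simp [*]

theorem fullMulti_four {n l : ℕ} (h : FullBip l n (2 * n)) : FullMulti n l 4 := by
  intro I hI
  obtain ⟨w, J, hw, rfl, hJ⟩ := Finset.card_eq_succ.1 hI
  obtain ⟨x, y, z, hxy, hxz, hyz, rfl⟩ := Finset.card_eq_three.1 hJ
  simp only [Finset.mem_insert, Finset.mem_singleton, not_or] at hw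
  obtain ⟨wx, wy, wz⟩ := hw
  rw [multiW_four n l (by simp; tauto)]
  refine ((h _ _ ?_ ?_ ?_).add (h _ _ ?_ ?_ ?_)).add (h _ _ ?_ ?_ ?_)
  all_goals first
    | exact Finset.disjoint_product.2 (Or.inl (by simp; tauto))
    | simp [*]

/-- Groups of four parts, plus possibly a single part. -/
theorem fullMulti_zero_one_mod_four {n l : ℕ} (hb : FullBip l n (2 * n))
    (hb' : ∀ m, 1 ≤ m → FullBip l (m * n) (4 * n)) {m : ℕ} (hm : m % 4 ≤ 1) : FullMulti n l m := by
  induction m using Nat.strong_induction_on with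
  | _ m ih =>
    by_cases h : m ≤ 1
    · exact FullMulti.of_le_one n l h
    · obtain ⟨k, rfl⟩ := Nat.exists_eq_add_of_le' (show 4 ≤ m by omega)
      rcases Nat.eq_zero_or_pos k with rfl | hk
      · exact fullMulti_four hb
      · exact (ih k (by omega) (by omega)).add (fullMulti_four hb) (hb' k hk)

theorem fullMulti_one_of_even {n m : ℕ} (hn : 2 ∣ n) (hn₆ : 6 ≤ n) (hm : m % 4 ≤ 1) :
    FullMulti n 1 m := by
  refine fullMulti_zero_one_mod_four (fullBip_one (by omega) hn (by omega) (by omega)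
    (by omega)).symm (fun k hk => ?_) hm
  have : n ≤ k * n := Nat.le_mul_of_pos_left n hk
  exact (fullBip_one (by omega) (hn.mul_left k) (by omega) (by omega) (by omega)).symm

theorem fullMulti_two_of_even {n m : ℕ} (hn : 2 ∣ n) (hn₆ : 6 ≤ n) : FullMulti n 2 m := by
  induction m with
  | zero => exact FullMulti.of_le_one n 2 (by omega)
  | succ m ih =>
    rcases Nat.eq_zero_or_pos m with rfl | hm
    · exact FullMulti.of_le_one n 2 le_rfl
    · have : n ≤ m * n := Nat.le_mul_of_pos_left n hm
      exact ih.succ (fullBip_two_even (hn.mul_left m) hn (by omega) hn₆)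

theorem fullMulti_two_one {m : ℕ} (hm : m % 4 ≤ 1) (hm₅ : 5 ≤ m) : FullMulti 2 1 m := by
  induction m using Nat.strong_induction_on with
  | _ m ih =>
    by_cases h₁ : m % 4 = 1
    · by_cases h : m = 5
      · subst h
        exact fullMulti_2_1_5
      · obtain ⟨k, rfl⟩ := Nat.exists_eq_add_of_le' (show 5 ≤ m by omega)
        exact (ih (k + 1) (by omega) (by omega) (by omega)).add_share fullMulti_2_1_5
          (fullBip_one (by omega) (by omega) (by omega) (by omega) (by omega))
    · by_cases h : 16 ≤ m
      · obtain ⟨k, rfl⟩ := Nat.exists_eq_add_of_le' (show 8 ≤ m by omega)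
        exact (ih k (by omega) (by omega) (by omega)).add fullMulti_2_1_8
          (fullBip_one (by omega) (by omega) (by omega) (by omega) (by omega))
      · obtain rfl | rfl : m = 8 ∨ m = 12 := by omega
        exacts [fullMulti_2_1_8, fullMulti_2_1_12]

theorem fullMulti_two_two {m : ℕ} (hm₅ : 5 ≤ m) : FullMulti 2 2 m := by
  induction m using Nat.strong_induction_on with
  | _ m ih =>
    by_cases h₁ : m % 4 ≤ 1
    · exact (fullMulti_two_one h₁ hm₅).mul_mult 2
    by_cases h : 10 ≤ m
    · obtain ⟨k, rfl⟩ := Nat.exists_eq_add_of_le' (show 5 ≤ m by omega)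
      exact (ih k (by omega) (by omega)).add (fullMulti_2_1_5.mul_mult 2)
        (fullBip_two_even (by omega) (by omega) (by omega) (by omega))
    · obtain rfl | rfl : m = 6 ∨ m = 7 := by omega
      exacts [fullMulti_2_2_6, fullMulti_2_2_7]

/-! ### Parts of size one -/

theorem fullMulti_one_one {m : ℕ} (hm : m % 16 = 1) : FullMulti 1 1 m := by
  induction m using Nat.strong_induction_on with
  | _ m ih =>
    by_cases h : m ≤ 1
    · exact FullMulti.of_le_one 1 1 h
    · obtain ⟨k, rfl⟩ := Nat.exists_eq_add_of_le' (show 17 ≤ m by omega)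
      rcases Nat.eq_zero_or_pos k with rfl | hk
      · exact fullMulti_1_1_17
      · exact (ih (k + 1) (by omega) (by omega)).add_share fullMulti_1_1_17
          (fullBip_one (by omega) (by omega) (by omega) (by omega) (by omega))

theorem fullMulti_one_two {m : ℕ} (hm : m % 8 ≤ 1) (hm₉ : 9 ≤ m) : FullMulti 1 2 m := by
  induction m using Nat.strong_induction_on with
  | _ m ih =>
    by_cases h₁ : m % 8 = 1
    · by_cases h : m = 9
      · subst h
        exact fullMulti_1_2_9
      · obtain ⟨k, rfl⟩ := Nat.exists_eq_add_of_le' (show 9 ≤ m by omega)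
        exact (ih (k + 1) (by omega) (by omega) (by omega)).add_share fullMulti_1_2_9
          (fullBip_two (by omega) (by omega))
    · by_cases h : 32 ≤ m
      · obtain ⟨k, rfl⟩ := Nat.exists_eq_add_of_le' (show 16 ≤ m by omega)
        exact (ih k (by omega) (by omega) (by omega)).add fullMulti_1_2_16
          (fullBip_two (by omega) (by omega))
      · obtain rfl | rfl : m = 16 ∨ m = 24 := by omega
        exacts [fullMulti_1_2_16, fullMulti_1_2_24]

theorem fullMulti_one_four {m : ℕ} (hm : m % 4 ≤ 1) (hm₉ : 9 ≤ m) : FullMulti 1 4 m := by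
  induction m using Nat.strong_induction_on with
  | _ m ih =>
    by_cases h₁ : m % 4 = 1
    · by_cases h : 17 ≤ m
      · obtain ⟨k, rfl⟩ := Nat.exists_eq_add_of_le' (show 9 ≤ m by omega)
        exact (ih (k + 1) (by omega) (by omega) (by omega)).add_share
          (fullMulti_1_2_9.mul_mult 2) ((fullBip_two (by omega) (by omega)).mul_mult 2)
      · obtain rfl | rfl : m = 9 ∨ m = 13 := by omega
        exacts [fullMulti_1_2_9.mul_mult 2, fullMulti_1_4_13]
    · by_cases h : 24 ≤ m
      · obtain ⟨k, rfl⟩ := Nat.exists_eq_add_of_le' (show 12 ≤ m by omega)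
        exact (ih k (by omega) (by omega) (by omega)).add fullMulti_1_4_12
          ((fullBip_two (by omega) (by omega)).mul_mult 2)
      · obtain rfl | rfl | rfl : m = 12 ∨ m = 16 ∨ m = 20 := by omega
        exacts [fullMulti_1_4_12, fullMulti_1_2_16.mul_mult 2, fullMulti_1_4_20]

theorem fullMulti_one_eight {m : ℕ} (hm₉ : 9 ≤ m) : FullMulti 1 8 m := by
  induction m using Nat.strong_induction_on with
  | _ m ih =>
    by_cases h₁ : m % 4 ≤ 1
    · exact (fullMulti_one_four h₁ hm₉).mul_mult 2
    by_cases h : 18 ≤ m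
    · obtain ⟨k, rfl⟩ := Nat.exists_eq_add_of_le' (show 9 ≤ m by omega)
      exact (ih k (by omega) (by omega)).add (fullMulti_1_2_9.mul_mult 4)
        (fullBip_eight (by omega) (by omega))
    · obtain rfl | rfl | rfl | rfl : m = 10 ∨ m = 11 ∨ m = 14 ∨ m = 15 := by omega
      exacts [fullMulti_1_8_10, fullMulti_1_8_11, fullMulti_1_8_14, fullMulti_1_8_15]

/-! ### Parts of odd size -/

section OddParts

variable {m n l : ℕ} {I : Finset ℕ}

/-- The blow-up of `K_m(l)` is the complete multipartite multigraph. -/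
theorem exists_transfer_blow [NeZero n] (hI : I.card = m) :
    ∃ (S : Set (ℕ × ZMod n)) (φ : ℕ × ZMod n → ℕ × ℕ), Set.InjOn φ S ∧
      (∀ x y, blow (ZMod n) (residueW m 1 l) x y ≠ 0 → x ∈ S ∧ y ∈ S) ∧
      (∀ x ∈ S, ∀ y ∈ S, multiW n l I (φ x) (φ y) = blow (ZMod n) (residueW m 1 l) x y) ∧
      ∀ u v, multiW n l I u v ≠ 0 → u ∈ φ '' S ∧ v ∈ φ '' S := by
  obtain ⟨f, hf⟩ := exists_bijOn_of_card hI
  have hS : ∀ u : ℕ × ℕ, u.1 ∈ I → u.2 < n →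
      u ∈ (fun x : ℕ × ZMod n => (f x.1, x.2.val)) '' {x | x.1 < m} := by
    rintro ⟨i, a⟩ hi ha
    obtain ⟨k, hk, rfl⟩ := hf.surjOn hi
    exact ⟨(k, (a : ZMod n)), hk, by simp [ZMod.val_cast_of_lt ha]⟩
  refine ⟨{x | x.1 < m}, fun x => (f x.1, x.2.val), ?_, ?_, ?_, ?_⟩
  · rintro ⟨i, a⟩ hi ⟨j, b⟩ hj hij
    simp only [Prod.mk.injEq] at hij ⊢
    exact ⟨hf.injOn hi hj hij.1, ZMod.val_injective n hij.2⟩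
  · intro x y hxy
    simpa using residueW_ne_zero hxy
  · rintro ⟨i, a⟩ hi ⟨j, b⟩ hj
    have hi : i < m := hi
    have hj : j < m := hj
    have h₁ : f i ∈ I := hf.mapsTo hi
    have h₂ : f j ∈ I := hf.mapsTo hj
    have h₃ : f i = f j ↔ i = j := hf.injOn.eq_iff hi hj
    simp [multiW, blow, residueW, hi, hj, h₁, h₂, h₃, ZMod.val_lt, Nat.mod_eq_of_lt]
  · intro u v huv
    have := multiW_ne_zero huv
    exact ⟨hS u this.1.1 this.1.2, hS v this.2.1 this.2.2⟩

/-- A decomposition of `K_m(l)` into cycles makes the multigraph with parts of size `n ≥ 3` full,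
even where `K_m(l)` itself is too small to be full. -/
theorem fullMulti_of_dec_residueW {q : ℕ} (hn : 3 ≤ n) (h : Dec (residueW m 1 l) 0 q) :
    FullMulti n l m := by
  intro I hI
  have : NeZero n := ⟨by omega⟩
  obtain ⟨S, φ, h₁, h₂, h₃, h₄⟩ := exists_transfer_blow (n := n) (l := l) hI
  exact Full.transfer ⟨_, fullWith_blow (T := ZMod n) (by rwa [ZMod.card]) h⟩ S φ h₁ h₂ h₃ h₄

theorem exists_dec_residueW_of_fullMulti (h : FullMulti 1 l m) : ∃ q, Dec (residueW m 1 l) 0 q := by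
  obtain ⟨N, -, -, h⟩ := h (Finset.range m) (Finset.card_range m)
  refine ⟨N, (h 0 N (by omega) (by omega)).transfer {x | x.1 < m ∧ x.2 < 1} Prod.fst ?_ ?_ ?_ ?_⟩
  · rintro ⟨i, a⟩ ⟨-, ha⟩ ⟨j, b⟩ ⟨-, hb⟩ hij
    simp only [Nat.lt_one_iff] at ha hb hij
    rw [ha, hb, hij]
  · intro x y hxy
    simpa using multiW_ne_zero hxy
  · rintro ⟨i, a⟩ ⟨hi, ha⟩ ⟨j, b⟩ ⟨hj, hb⟩
    simp only at hi hj ha hb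
    simp [multiW, residueW, hi, hj, Nat.mod_eq_of_lt, Nat.lt_one_iff.1 ha, Nat.lt_one_iff.1 hb]
  · intro u v huv
    have := residueW_ne_zero huv
    exact ⟨⟨(u, 0), by simpa using this.1, rfl⟩, ⟨(v, 0), by simpa using this.2, rfl⟩⟩

theorem fullMulti_of_fullMulti_one (hn : 3 ≤ n) (h : FullMulti 1 l m) : FullMulti n l m := by
  obtain ⟨q, h⟩ := exists_dec_residueW_of_fullMulti h
  exact fullMulti_of_dec_residueW hn h

end OddParts

theorem fullMulti_eight_of_le {n m : ℕ} (hn : 3 ≤ n) (hmn : 9 ≤ m * n) (hm : m ≤ 7) :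
    FullMulti n 8 m := by
  by_cases h : 5 ≤ n
  · clear hm hmn
    induction m with
    | zero => exact FullMulti.of_le_one n 8 (by omega)
    | succ m ih =>
      rcases Nat.eq_zero_or_pos m with rfl | hm
      · exact FullMulti.of_le_one n 8 le_rfl
      · have : n ≤ m * n := Nat.le_mul_of_pos_left n hm
        exact ih.succ (fullBip_eight (by omega) h)
  by_cases h₄ : n = 4
  · subst h₄
    exact (fullMulti_of_four_dvd (by omega) hmn).mul_mult 8
  obtain rfl : n = 3 := by omega
  have h₃ := fullMulti_3_8_3
  have h₄ := fullMulti_3_4_4.mul_mult 2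
  obtain rfl | rfl | rfl | rfl | rfl : m = 3 ∨ m = 4 ∨ m = 5 ∨ m = 6 ∨ m = 7 := by omega
  · exact h₃
  · exact h₄
  · exact fullMulti_3_4_5.mul_mult 2
  · exact h₃.add h₃ (fullBip_eight (by omega) (by omega))
  · exact h₃.add h₄ (fullBip_eight (by omega) (by omega))

theorem fullMulti_four_of_odd {n m : ℕ} (hn : 3 ≤ n) (hn₂ : Odd n) (hm : m = 4 ∨ m = 5) :
    FullMulti n 4 m := by
  by_cases h : n = 3
  · subst h
    rcases hm with rfl | rfl
    exacts [fullMulti_3_4_4, fullMulti_3_4_5]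
  · have hn₅ : 5 ≤ n := by
      obtain ⟨k, rfl⟩ := hn₂
      omega
    refine fullMulti_zero_one_mod_four (fullBip_four (by omega) (by omega) hn₅).symm
      (fun k hk => ?_) (by omega)
    have : n ≤ k * n := Nat.le_mul_of_pos_left n hk
    exact (fullBip_four (by omega) (by omega) (by omega)).symm

/-! ### All complete equipartite multigraphs with even degrees -/

/-- One of two consecutive numbers is odd, so that a power of two divides only the other one. -/
theorem two_pow_dvd_or {k x m : ℕ} (h : 2 ^ k ∣ x * (m * (m - 1))) (hx : Odd x) :
    2 ^ k ∣ m ∨ 2 ^ k ∣ m - 1 := by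
  have h := (Nat.Coprime.pow_left k (Nat.coprime_two_left.2 hx)).dvd_of_dvd_mul_left h
  rcases Nat.even_or_odd m with hm | hm
  · rcases Nat.eq_zero_or_pos m with rfl | hpos
    · simp
    · have : Odd (m - 1) := Nat.Even.sub_odd hpos hm odd_one
      exact Or.inl ((Nat.Coprime.pow_left k (Nat.coprime_two_left.2 this)).dvd_of_dvd_mul_right h)
  · exact Or.inr ((Nat.Coprime.pow_left k (Nat.coprime_two_left.2 hm)).dvd_of_dvd_mul_left h)

/-- The power of two in `l`, up to `8`, determines the residue of `m` modulo `16`, `8`, `4`. At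
least `9` parts are blown up from parts of size one, fewer parts need separate constructions. -/
theorem fullMulti_of_odd {m n l : ℕ} (hn : Odd n) (hmn : 9 ≤ m * n)
    (h : 2 ^ 4 ∣ l * (m * (m - 1))) (hdeg : ¬ (Odd l ∧ Even m)) : FullMulti n l m := by
  have hn₁ : n ≠ 0 := by
    rintro rfl
    simp at hmn
  have hn₂ : n ≠ 2 := by
    rintro rfl
    exact absurd hn (by decide)
  -- from multiplicity `2 ^ k` to its multiples
  have mult : ∀ k x : ℕ, FullMulti n k m → FullMulti n (k * x) m := fun k x h => by
    rw [mul_comm]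
    exact h.mul_mult x
  -- in the case analysis below, `l` is `8c`, `4(2c + 1)`, `2(2b + 1)` or `2a + 1`
  by_cases h₉ : 9 ≤ m
  · suffices FullMulti 1 l m by
      by_cases h₁ : n = 1
      · rwa [h₁]
      · exact fullMulti_of_fullMulti_one (by omega) this
    have mult : ∀ k x : ℕ, FullMulti 1 k m → FullMulti 1 (k * x) m := fun k x h => by
      rw [mul_comm]
      exact h.mul_mult x
    rcases Nat.even_or_odd' l with ⟨a, rfl | rfl⟩
    · rcases Nat.even_or_odd' a with ⟨b, rfl | rfl⟩
      · rcases Nat.even_or_odd' b with ⟨c, rfl | rfl⟩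
        · have := mult 8 c (fullMulti_one_eight h₉)
          rwa [show 2 * (2 * (2 * c)) = 8 * c by ring]
        · have h4 : 2 ^ 2 * 2 ^ 2 ∣ 2 ^ 2 * ((2 * c + 1) * (m * (m - 1))) := by
            convert h using 1 <;> ring
          have := two_pow_dvd_or (Nat.dvd_of_mul_dvd_mul_left (by norm_num) h4) (by simp)
          have := mult 4 (2 * c + 1) (fullMulti_one_four (by omega) h₉)
          rwa [show 2 * (2 * (2 * c + 1)) = 4 * (2 * c + 1) by ring]
      · have h4 : 2 * 2 ^ 3 ∣ 2 * ((2 * b + 1) * (m * (m - 1))) := by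
          convert h using 1 <;> ring
        have := two_pow_dvd_or (Nat.dvd_of_mul_dvd_mul_left (by norm_num) h4) (by simp)
        exact mult 2 _ (fullMulti_one_two (by omega) h₉)
    · have := two_pow_dvd_or h (by simp)
      have hm : ¬ Even m := fun hm => hdeg ⟨by simp, hm⟩
      have : m % 16 = 1 := by
        rw [Nat.even_iff] at hm
        omega
      have := mult 1 (2 * a + 1) (fullMulti_one_one this)
      rwa [one_mul] at this
  · have hn₃ : 3 ≤ n := by
      by_contra hn₃
      obtain rfl : n = 1 := by omega
      omega
    have hm₂ : 2 ≤ m ∨ m = 1 := by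
      rcases Nat.eq_zero_or_pos m with rfl | h
      · simp at hmn
      · omega
    rcases hm₂ with hm₂ | rfl
    swap
    · exact FullMulti.of_le_one n l le_rfl
    rcases Nat.even_or_odd' l with ⟨a, rfl | rfl⟩
    · by_cases h₈ : m = 8
      · subst h₈
        exact mult 2 a (fullMulti_of_dec_residueW hn₃ dec_residueW_eight)
      rcases Nat.even_or_odd' a with ⟨b, rfl | rfl⟩
      · rcases Nat.even_or_odd' b with ⟨c, rfl | rfl⟩
        · have := mult 8 c (fullMulti_eight_of_le hn₃ hmn (by omega))
          rwa [show 2 * (2 * (2 * c)) = 8 * c by ring]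
        · have h4 : 2 ^ 2 * 2 ^ 2 ∣ 2 ^ 2 * ((2 * c + 1) * (m * (m - 1))) := by
            convert h using 1 <;> ring
          have := two_pow_dvd_or (Nat.dvd_of_mul_dvd_mul_left (by norm_num) h4) (by simp)
          have := mult 4 (2 * c + 1) (fullMulti_four_of_odd hn₃ hn (by omega))
          rwa [show 2 * (2 * (2 * c + 1)) = 4 * (2 * c + 1) by ring]
      · have h4 : 2 * 2 ^ 3 ∣ 2 * ((2 * b + 1) * (m * (m - 1))) := by
          convert h using 1 <;> ring
        have := two_pow_dvd_or (Nat.dvd_of_mul_dvd_mul_left (by norm_num) h4) (by simp)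
        omega
    · have := two_pow_dvd_or h (by simp)
      omega

/-- The complete equipartite multigraphs with even degrees, a number of edges divisible by `8`, and
at least `9` vertices are full. -/
theorem fullMulti_of_dvd {m n l : ℕ} (hmn : 9 ≤ m * n) (h : 16 ∣ l * n ^ 2 * m * (m - 1))
    (hdeg : ¬ (Odd l ∧ Odd n ∧ Even m)) : FullMulti n l m := by
  have mult : ∀ k x : ℕ, FullMulti n k m → FullMulti n (k * x) m := fun k x h => by
    rw [mul_comm]
    exact h.mul_mult x
  rcases Nat.even_or_odd' n with ⟨a, rfl | rfl⟩
  · rcases Nat.even_or_odd' a with ⟨b, rfl | rfl⟩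
    · have := mult 1 l (fullMulti_of_four_dvd ⟨b, by ring⟩ hmn)
      rwa [one_mul] at this
    · rcases Nat.even_or_odd' l with ⟨c, rfl | rfl⟩
      · refine mult 2 c ?_
        by_cases hb : b = 0
        · subst hb
          exact fullMulti_two_two (by omega)
        · exact fullMulti_two_of_even (by omega) (by omega)
      · have h4 : 2 ^ 2 * 2 ^ 2 ∣
            2 ^ 2 * (((2 * c + 1) * (2 * b + 1) ^ 2) * (m * (m - 1))) := by
          convert h using 1 <;> ring
        have h4 := two_pow_dvd_or (Nat.dvd_of_mul_dvd_mul_left (by norm_num) h4)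
          (Odd.mul (by simp) (Odd.pow (by simp)))
        have := mult 1 (2 * c + 1) (by
          by_cases hb : b = 0
          · subst hb
            exact fullMulti_two_one (by omega) (by omega)
          · exact fullMulti_one_of_even (by omega) (by omega) (by omega))
        rwa [one_mul] at this
  · have hn : Odd (2 * a + 1) := by simp
    refine fullMulti_of_odd hn hmn ?_ (fun h => hdeg ⟨h.1, hn, h.2⟩)
    have h' : 2 ^ 4 ∣ (2 * a + 1) ^ 2 * (l * (m * (m - 1))) := by
      convert h using 1 <;> ring
    exact (Nat.Coprime.pow_left 4 (Nat.coprime_two_left.2 hn.pow)).dvd_of_dvd_mul_left h'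

/-! ### Odd degrees -/

/-- `K_16` decomposes into `8` paths and `7` cycles; the cycles are blown up into a full multigraph,
the paths into multigraphs that need `n` paths each. -/
theorem exists_hasRange_sixteen {n : ℕ} (hn : Odd n) {I : Finset ℕ} (hI : I.card = 16) :
    ∃ N, 8 * n < N ∧ HasRange (multiW n 1 I) (8 * n) N := by
  obtain ⟨P, C, hPC, hP, hC, h⟩ := exists_dec_residueW_sixteen
  by_cases h₁ : n = 1
  · subst h₁
    exact ⟨15, by omega, fun p q hpq hp => dec_multiW_of_residueW (hPC ▸ h p q hpq hp) hI⟩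
  · have hn₃ : 3 ≤ n := by
      obtain ⟨k, rfl⟩ := hn
      omega
    have : NeZero n := ⟨by omega⟩
    have hnn : n * 1 ≤ n * n := Nat.mul_le_mul_left n (by omega)
    obtain ⟨S, φ, h₁, h₂, h₃, h₄⟩ := exists_transfer_blow (n := n) (l := 1) hI
    have hF := fullWith_blow (T := ZMod n) (by rwa [ZMod.card]) hC
    rw [ZMod.card] at hF
    have hR := hasRange_blow_paths hn hn₃ hF (by omega) hP (by omega)
    refine ⟨_, ?_, (hR.congr ?_).transfer S φ h₁ h₂ h₃ h₄⟩
    · omega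
    · rw [hPC, blow_add, add_comm]

/-- Groups of `16` parts, and complete bipartite graphs between them. -/
theorem exists_hasRange_multiW {n : ℕ} (hn : Odd n) (k : ℕ) :
    ∀ I : Finset ℕ, I.card = 16 * (k + 1) →
      ∃ N, 8 * (k + 1) * n < N ∧ HasRange (multiW n 1 I) (8 * (k + 1) * n) N := by
  have hn₁ := hn.pos
  induction k with
  | zero => exact fun I hI => exists_hasRange_sixteen hn hI
  | succ k ih =>
    intro I hI
    obtain ⟨J, hJI, hJ⟩ := Finset.exists_subset_card_eq (show 16 ≤ I.card by omega)
    have hK : (I \ J).card = 16 * (k + 1) := by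
      rw [Finset.card_sdiff_of_subset hJI]
      omega
    have hd : Disjoint J (I \ J) := Finset.disjoint_sdiff
    rw [← Finset.union_sdiff_of_subset hJI, multiW_union n 1 hd]
    obtain ⟨N₁, h₁, r₁⟩ := exists_hasRange_sixteen hn hJ
    obtain ⟨N₂, h₂, r₂⟩ := ih _ hK
    have hb : FullBip 1 (16 * n) (16 * (k + 1) * n) :=
      fullBip_one (by omega) ⟨8 * (k + 1) * n, by ring⟩ (by omega) (by
        have : 1 * 1 ≤ (k + 1) * n := Nat.mul_le_mul (by omega) hn₁
        rw [mul_assoc]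
        omega) (by
        have : 1 * 1 ≤ (k + 1) * n := Nat.mul_le_mul (by omega) hn₁
        rw [mul_assoc]
        omega)
    obtain ⟨N, hN, r⟩ := (r₁.add r₂ h₁.le h₂.le).add_full (by omega)
      (hb (J ×ˢ Finset.range n) ((I \ J) ×ˢ Finset.range n)
        (Finset.disjoint_product.2 (Or.inl hd)) (by simp [hJ]) (by simp [hK]))
    have e : 8 * (k + 1 + 1) * n = 8 * n + 8 * (k + 1) * n := by ring
    rw [e]
    exact ⟨N, by omega, r⟩

/-- A complete equipartite multigraph with odd degrees decomposes with any number of paths which is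
at least half of the number of vertices. -/
theorem exists_hasRange_of_odd {m n l : ℕ} (hn : Odd n) (hl : Odd l) (hm : Even m) (hm₀ : m ≠ 0)
    (h : 16 ∣ l * n ^ 2 * m * (m - 1)) {I : Finset ℕ} (hI : I.card = m) :
    ∃ N k, 2 * k = m * n ∧ k ≤ N ∧ HasRange (multiW n l I) k N := by
  have h' : 2 ^ 4 ∣ (l * n ^ 2) * (m * (m - 1)) := by
    convert h using 1 <;> ring
  obtain ⟨k, rfl⟩ : ∃ k, m = 16 * (k + 1) := by
    have := two_pow_dvd_or h' (hl.mul hn.pow)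
    rw [Nat.even_iff] at hm
    exact ⟨m / 16 - 1, by omega⟩
  obtain ⟨c, rfl⟩ := hl
  obtain ⟨N, hN, r⟩ := exists_hasRange_multiW hn k I hI
  have hpos : 1 ≤ n := hn.pos
  have hfull : FullMulti n (2 * c) (16 * (k + 1)) := by
    refine fullMulti_of_dvd ?_ ?_ (fun h => ?_)
    · have : 16 * (k + 1) * 1 ≤ 16 * (k + 1) * n := Nat.mul_le_mul_left _ hpos
      omega
    · exact Dvd.dvd.mul_right (Dvd.dvd.mul_left (Dvd.intro _ rfl) _) _
    · exact Nat.not_odd_iff_even.2 (even_two_mul c) h.1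
  obtain ⟨N', hN', r'⟩ := r.add_full hN (hfull I hI)
  refine ⟨N', _, by ring, by omega, r'.congr ?_⟩
  funext x y
  simp only [multiW, Pi.add_apply]
  split_ifs
  · ring
  · rfl

/-! ### From lists to copies of paths and cycles -/

section Copies

variable {V : Type*}

section Lists

variable [DecidableEq V]

theorem trailW_le_one {l : List V} (hl : l.Nodup) (x y : V) : trailW l x y ≤ 1 := by
  induction l with
  | nil => simp
  | cons a t ih =>
    cases t with
    | nil => simp
    | cons b t =>
      have ih := ih (List.nodup_cons.1 hl).2
      rw [trailW_cons_cons, Pi.add_apply, Pi.add_apply]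
      by_cases h : trailW (b :: t) x y = 0
      · rw [h, edgeW]
        split_ifs <;> simp
      · have hm := trailW_ne_zero_mem h
        have ha := (List.nodup_cons.1 hl).1
        have : edgeW a b x y = 0 := by
          rw [edgeW, if_neg]
          rintro (⟨rfl, -⟩ | ⟨rfl, -⟩)
          exacts [ha hm.1, ha hm.2]
        omega

theorem cycleW_le_one {l : List V} (hl : l.Nodup) (h₈ : l.length = 8) (x y : V) :
    cycleW l x y ≤ 1 := by
  obtain ⟨v₀, v₁, v₂, v₃, v₄, v₅, v₆, v₇, rfl⟩ := exists_eq_of_length_eight h₈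
  have h := trailW_le_one hl x y
  have h' : cycleW [v₀, v₁, v₂, v₃, v₄, v₅, v₆, v₇] =
      trailW [v₀, v₁, v₂, v₃, v₄, v₅, v₆, v₇] + edgeW v₇ v₀ :=
    trailW_append_pair [v₀, v₁, v₂, v₃, v₄, v₅, v₆] v₇ v₀
  rw [h', Pi.add_apply, Pi.add_apply]
  by_cases h0 : edgeW v₇ v₀ x y = 0
  · omega
  · have h1 : edgeW v₇ v₀ x y = 1 := by
      rw [edgeW] at h0 ⊢
      split_ifs at h0 ⊢ <;> simp_all
    have h2 : trailW [v₀, v₁, v₂, v₃, v₄, v₅, v₆, v₇] x y = 0 := by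
      simp only [edgeW, ite_eq_right_iff, one_ne_zero, imp_false, not_not] at h0
      simp only [List.nodup_cons, List.mem_cons, not_or] at hl
      rcases h0 with ⟨rfl, rfl⟩ | ⟨rfl, rfl⟩ <;>
        simp only [trailW_cons_cons, trailW_singleton, Pi.add_apply, edgeW, Pi.zero_apply] <;>
        simp [Ne.symm, hl, eq_comm]
    omega

theorem trailW_ne_zero_iff (v : Fin 9 → V) (x y : V) : trailW (List.ofFn v) x y ≠ 0 ↔
    ∃ a b : Fin 9, (SimpleGraph.pathGraph 9).Adj a b ∧ v a = x ∧ v b = y := by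
  have h : trailW (List.ofFn v) x y = ∑ k : Fin 8, edgeW (v k.castSucc) (v k.succ) x y := by
    simp only [List.ofFn_succ, List.ofFn_zero, trailW_cons_cons, trailW_singleton, Pi.add_apply,
      Fin.sum_univ_eight, add_zero, add_assoc]
    rfl
  rw [h, ne_eq, Finset.sum_eq_zero_iff]
  push Not
  constructor
  · rintro ⟨k, -, hk⟩
    simp only [edgeW, ne_eq, ite_eq_right_iff, one_ne_zero, imp_false, not_not] at hk
    rcases hk with ⟨hx, hy⟩ | ⟨hy, hx⟩
    · exact ⟨_, _, SimpleGraph.pathGraph_adj.2 (Or.inl (by simp)), hx, hy⟩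
    · exact ⟨_, _, SimpleGraph.pathGraph_adj.2 (Or.inr (by simp)), hx, hy⟩
  · rintro ⟨a, b, hab, rfl, rfl⟩
    rcases SimpleGraph.pathGraph_adj.1 hab with hab | hab
    · refine ⟨⟨a, by omega⟩, Finset.mem_univ _, ?_⟩
      rw [show (⟨a, by omega⟩ : Fin 8).castSucc = a from rfl,
        show (⟨a, by omega⟩ : Fin 8).succ = b from Fin.ext hab]
      simp [edgeW]
    · refine ⟨⟨b, by omega⟩, Finset.mem_univ _, ?_⟩
      rw [show (⟨b, by omega⟩ : Fin 8).castSucc = b from rfl,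
        show (⟨b, by omega⟩ : Fin 8).succ = a from Fin.ext hab]
      simp [edgeW]

theorem cycleW_ne_zero_iff (v : Fin 8 → V) (x y : V) : cycleW (List.ofFn v) x y ≠ 0 ↔
    ∃ a b : Fin 8, (SimpleGraph.cycleGraph 8).Adj a b ∧ v a = x ∧ v b = y := by
  have h : cycleW (List.ofFn v) x y = ∑ k : Fin 8, edgeW (v k) (v (k + 1)) x y := by
    simp only [List.ofFn_succ, List.ofFn_zero, cycleW_cons, List.cons_append, List.nil_append,
      trailW_cons_cons, trailW_singleton, Pi.add_apply, Fin.sum_univ_eight, add_zero,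
      add_assoc]
    rfl
  rw [h, ne_eq, Finset.sum_eq_zero_iff]
  push Not
  constructor
  · rintro ⟨k, -, hk⟩
    simp only [edgeW, ne_eq, ite_eq_right_iff, one_ne_zero, imp_false, not_not] at hk
    rcases hk with ⟨hx, hy⟩ | ⟨hy, hx⟩
    · exact ⟨_, _, SimpleGraph.cycleGraph_adj.2 (Or.inr (by simp)), hx, hy⟩
    · exact ⟨_, _, SimpleGraph.cycleGraph_adj.2 (Or.inl (by simp)), hx, hy⟩
  · rintro ⟨a, b, hab, rfl, rfl⟩
    rcases SimpleGraph.cycleGraph_adj.1 hab with hab | hab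
    · refine ⟨b, Finset.mem_univ _, ?_⟩
      rw [show b + 1 = a by rw [← hab]; abel]
      simp [edgeW]
    · refine ⟨a, Finset.mem_univ _, ?_⟩
      rw [show a + 1 = b by rw [← hab]; abel]
      simp [edgeW]

/-- A decomposition as a family of injective sequences of vertices. -/
theorem Dec.exists_families {W : V → V → ℕ} {p q : ℕ} (h : Dec W p q) :
    ∃ (P : Fin p → Fin 9 → V) (C : Fin q → Fin 8 → V), (∀ i, Function.Injective (P i)) ∧
      (∀ j, Function.Injective (C j)) ∧ ∀ x y,
        ∑ i, trailW (List.ofFn (P i)) x y + ∑ j, cycleW (List.ofFn (C j)) x y = W x y := by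
  induction h with
  | zero =>
    exact ⟨Fin.elim0, Fin.elim0, fun i => i.elim0, fun i => i.elim0, fun x y => by simp⟩
  | path l hl hn _ ih =>
    obtain ⟨P, C, hP, hC, h⟩ := ih
    obtain ⟨f, rfl⟩ : ∃ f : Fin 9 → V, l = List.ofFn f :=
      ⟨fun i => l.get (i.cast hl.symm), by
        exact (List.ofFn_congr hl.symm _).trans (List.ofFn_get l) |>.symm⟩
    refine ⟨Fin.cons f P, C, Fin.cases (List.nodup_ofFn.1 hn) hP, hC, fun x y => ?_⟩
    rw [Fin.sum_univ_succ, Pi.add_apply, Pi.add_apply, ← h]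
    simp [add_assoc]
  | cycle l hl hn _ ih =>
    obtain ⟨P, C, hP, hC, h⟩ := ih
    obtain ⟨f, rfl⟩ : ∃ f : Fin 8 → V, l = List.ofFn f :=
      ⟨fun i => l.get (i.cast hl.symm), by
        exact (List.ofFn_congr hl.symm _).trans (List.ofFn_get l) |>.symm⟩
    refine ⟨P, Fin.cons f C, hP, Fin.cases (List.nodup_ofFn.1 hn) hC, fun x y => ?_⟩
    rw [Fin.sum_univ_succ, Pi.add_apply, Pi.add_apply, ← h]
    simp only [Fin.cons_zero, Fin.cons_succ]
    omega

end Lists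

theorem mem_edgeSet_toSubgraph_iff {U : Type*} {G : SimpleGraph U} {H : SimpleGraph V}
    (f : SimpleGraph.Copy G H) (x y : V) :
    s(x, y) ∈ f.toSubgraph.edgeSet ↔ ∃ a b, G.Adj a b ∧ f.toHom a = x ∧ f.toHom b = y := by
  rw [SimpleGraph.Subgraph.mem_edgeSet, SimpleGraph.Copy.toSubgraph, SimpleGraph.Subgraph.map_adj]
  rfl

theorem sum_eq_ncard {ι : Type*} [Fintype ι] {w : ι → ℕ} {s : ι → Prop} (h₁ : ∀ i, w i ≤ 1)
    (hs : ∀ i, s i ↔ w i ≠ 0) : {i | s i}.ncard = ∑ i, w i := by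
  classical
  rw [Set.ncard_eq_toFinset_card', Set.toFinset_ofPred, Finset.card_filter]
  refine Finset.sum_congr rfl fun i _ => ?_
  have := h₁ i
  split_ifs with h <;> rw [hs] at h <;> omega

theorem isPathCycleDecomposable_of_dec [DecidableEq V] {M : Multigraph V} {W : V → V → ℕ} {p q : ℕ}
    (h : Dec W p q) (hW : ∀ x y, W x y = M.mult s(x, y)) : M.IsPathCycleDecomposable 8 p q := by
  obtain ⟨P, C, hP, hC, h⟩ := h.exists_families
  have hPadj : ∀ i, ∀ {a b : Fin 9}, (SimpleGraph.pathGraph 9).Adj a b →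
      M.toSimpleGraph.Adj (P i a) (P i b) := fun i a b hab => by
    have h₁ := (trailW_ne_zero_iff (P i) (P i a) (P i b)).2 ⟨a, b, hab, rfl, rfl⟩
    have h₂ : trailW (List.ofFn (P i)) (P i a) (P i b) ≤
      ∑ i', trailW (List.ofFn (P i')) (P i a) (P i b) :=
      Finset.single_le_sum (f := fun i' => trailW (List.ofFn (P i')) (P i a) (P i b))
        (fun _ _ => Nat.zero_le _) (Finset.mem_univ i)
    have h₃ := h (P i a) (P i b)
    rw [hW] at h₃
    change 0 < M.mult s(P i a, P i b)
    omega
  have hCadj : ∀ j, ∀ {a b : Fin 8}, (SimpleGraph.cycleGraph 8).Adj a b →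
      M.toSimpleGraph.Adj (C j a) (C j b) := fun j a b hab => by
    have h₁ := (cycleW_ne_zero_iff (C j) (C j a) (C j b)).2 ⟨a, b, hab, rfl, rfl⟩
    have h₂ : cycleW (List.ofFn (C j)) (C j a) (C j b) ≤
      ∑ j', cycleW (List.ofFn (C j')) (C j a) (C j b) :=
      Finset.single_le_sum (f := fun j' => cycleW (List.ofFn (C j')) (C j a) (C j b))
        (fun _ _ => Nat.zero_le _) (Finset.mem_univ j)
    have h₃ := h (C j a) (C j b)
    rw [hW] at h₃
    change 0 < M.mult s(C j a, C j b)
    omega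
  refine ⟨fun i => ⟨⟨P i, hPadj i⟩, hP i⟩, fun j => ⟨⟨C j, hCadj j⟩, hC j⟩, ?_⟩
  refine Sym2.ind fun x y => ?_
  rw [← hW, ← h]
  refine congrArg₂ _ (sum_eq_ncard (fun i => ?_) fun i => ?_)
    (sum_eq_ncard (fun j => ?_) fun j => ?_)
  · exact trailW_le_one (List.nodup_ofFn.2 (hP i)) x y
  · rw [trailW_ne_zero_iff, mem_edgeSet_toSubgraph_iff]
    rfl
  · exact cycleW_le_one (List.nodup_ofFn.2 (hC j)) (by simp) x y
  · rw [cycleW_ne_zero_iff, mem_edgeSet_toSubgraph_iff]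
    rfl

/-! ### Counting edges -/

theorem ncard_edgeSet_toSubgraph {U : Type*} {G : SimpleGraph U} {H : SimpleGraph V}
    (f : SimpleGraph.Copy G H) : f.toSubgraph.edgeSet.ncard = G.edgeSet.ncard := by
  have : f.toSubgraph.edgeSet = Sym2.map f.toHom '' G.edgeSet := by
    simp [SimpleGraph.Copy.toSubgraph]
  rw [this, Set.ncard_image_of_injective _ (Sym2.map.injective f.injective')]

theorem ncard_edgeSet_pathGraph_nine : (SimpleGraph.pathGraph 9).edgeSet.ncard = 8 := by
  have h : (SimpleGraph.pathGraph 9).edgeSet =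
      Set.range fun k : Fin 8 => s(k.castSucc, k.succ) := by
    ext e
    induction e with | h a b =>
    rw [SimpleGraph.mem_edgeSet, SimpleGraph.pathGraph_adj]
    decide +revert
  rw [h, ← Set.image_univ, Set.ncard_image_of_injective _ (by decide), Set.ncard_univ, Nat.card_fin]

theorem ncard_edgeSet_cycleGraph_eight : (SimpleGraph.cycleGraph 8).edgeSet.ncard = 8 := by
  rw [Set.ncard_eq_toFinset_card']
  decide +kernel

/-- Double counting of the incidences between edges and pieces. -/
theorem sum_ncard_mem [Fintype V] [DecidableEq V] {p : ℕ} (E : Fin p → Set (Sym2 V))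
    (hE : ∀ i, (E i).ncard = 8) : ∑ e : Sym2 V, {i | e ∈ E i}.ncard = 8 * p := by
  classical
  have h : ∀ e : Sym2 V, {i | e ∈ E i}.ncard = ∑ i, if e ∈ E i then 1 else 0 := fun e => by
    rw [Set.ncard_eq_toFinset_card', Set.toFinset_ofPred, Finset.card_filter]
  simp only [h]
  rw [Finset.sum_comm]
  have h' : ∀ i, (∑ e : Sym2 V, if e ∈ E i then 1 else 0) = 8 := fun i => by
    rw [← hE i, Set.ncard_eq_toFinset_card', ← Finset.card_filter]
    congr 1
    ext e
    simp
  simp [h', mul_comm]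

theorem edgeCount_of_isPathCycleDecomposable [Fintype V] [DecidableEq V] {M : Multigraph V}
    {p q : ℕ} (h : M.IsPathCycleDecomposable 8 p q) : M.edgeCount = 8 * (p + q) := by
  obtain ⟨P, C, h⟩ := h
  rw [Multigraph.edgeCount, ← Finset.sum_congr rfl fun e _ => h e, Finset.sum_add_distrib, mul_add,
    sum_ncard_mem, sum_ncard_mem]
  · exact fun j => (ncard_edgeSet_toSubgraph (C j)).trans ncard_edgeSet_cycleGraph_eight
  · exact fun i => (ncard_edgeSet_toSubgraph (P i)).trans ncard_edgeSet_pathGraph_nine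

end Copies

section Equipartite

variable {m n l : ℕ}

/-- The multigraph obtained from `K_m ∘ K̄_n` by replacing each edge by `l` parallel edges. -/
noncomputable abbrev equipartite (m n l : ℕ) : Multigraph (Fin m × Fin n) :=
  ((⊤ : SimpleGraph (Fin m)).wreathProduct (⊥ : SimpleGraph (Fin n))).fold l

theorem mult_equipartite (x y : Fin m × Fin n) : (equipartite m n l).mult s(x, y) =
    if x.1 ≠ y.1 then l else 0 := by
  simp [equipartite, SimpleGraph.fold, SimpleGraph.wreathProduct]

theorem degree_equipartite (x : Fin m × Fin n) :
    (equipartite m n l).degree x = l * (n * (m - 1)) := by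
  rw [Multigraph.degree, Finset.sum_congr rfl fun y _ => mult_equipartite x y,
    Fintype.sum_prod_type]
  have h' : ∀ i : Fin m, (∑ _ : Fin n, if x.1 ≠ i then l else 0) = if x.1 ≠ i then n * l else 0 :=
    fun i => by
      rw [Finset.sum_const, Finset.card_univ, Fintype.card_fin, smul_eq_mul, mul_ite, mul_zero]
  rw [Finset.sum_congr rfl fun i _ => h' i, ← Finset.sum_filter, Finset.sum_const, Finset.filter_ne,
    Finset.card_erase_of_mem (Finset.mem_univ _), Finset.card_univ, Fintype.card_fin, smul_eq_mul]
  ring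

open Classical in
theorem two_mul_edgeCount_equipartite :
    2 * (equipartite m n l).edgeCount = l * n ^ 2 * m * (m - 1) := by
  set G := SimpleGraph.wreathProduct (⊤ : SimpleGraph (Fin m)) (⊥ : SimpleGraph (Fin n)) with hG
  have h₁ : (G.fold l).edgeCount = l * G.edgeFinset.card := by
    have h : ∀ e, (G.fold l).mult e = if e ∈ G.edgeFinset then l else 0 := fun e => by
      simp [SimpleGraph.fold]
    rw [Multigraph.edgeCount, Finset.sum_congr rfl fun e _ => h e, Finset.sum_ite_mem,
      Finset.univ_inter, Finset.sum_const, smul_eq_mul, mul_comm]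
  have h₂ : ∀ x, (G.fold l).degree x = l * G.degree x := fun x => by
    have h : ∀ y, (G.fold l).mult s(x, y) = if y ∈ G.neighborFinset x then l else 0 := fun y => by
      simp [SimpleGraph.fold]
    rw [Multigraph.degree, Finset.sum_congr rfl fun y _ => h y, Finset.sum_ite_mem,
      Finset.univ_inter, Finset.sum_const, smul_eq_mul, mul_comm,
      SimpleGraph.card_neighborFinset_eq_degree]
  have h₃ := G.sum_degrees_eq_twice_card_edges
  rw [h₁, mul_left_comm, ← h₃, Finset.mul_sum, ← Finset.sum_congr rfl fun x _ => h₂ x,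
    Finset.sum_congr rfl fun x _ => degree_equipartite x]
  simp only [Finset.sum_const, Finset.card_univ, Fintype.card_prod, Fintype.card_fin, smul_eq_mul]
  ring

theorem edgeCount_equipartite : (equipartite m n l).edgeCount = l * n ^ 2 * m * (m - 1) / 2 := by
  rw [← two_mul_edgeCount_equipartite, Nat.mul_div_cancel_left _ (by norm_num)]

theorem oddCount_equipartite_of_odd (h : Odd (l * (n * (m - 1)))) :
    (equipartite m n l).oddCount = m * n := by
  simp [Multigraph.oddCount, degree_equipartite, h]

theorem oddCount_equipartite_of_not_odd (h : ¬ Odd (l * (n * (m - 1)))) :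
    (equipartite m n l).oddCount = 0 := by
  simp only [Multigraph.oddCount, degree_equipartite, h]
  simp

theorem isPathCycleDecomposable_of_dec_multiW {p q : ℕ} (h : Dec (multiW n l (Finset.range m)) p q)
    (hm : m ≠ 0) (hn : n ≠ 0) : (equipartite m n l).IsPathCycleDecomposable 8 p q := by
  have : NeZero m := ⟨hm⟩
  have : NeZero n := ⟨hn⟩
  have hd : Dec (fun x y : Fin m × Fin n => if x.1 ≠ y.1 then l else 0) p q := by
    refine h.transfer {x | x.1 < m ∧ x.2 < n} (fun x => (Fin.ofNat m x.1, Fin.ofNat n x.2))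
      ?_ ?_ ?_ ?_
    · rintro ⟨i, a⟩ ⟨hi, ha⟩ ⟨j, b⟩ ⟨hj, hb⟩ hij
      simpa [Fin.ext_iff, Nat.mod_eq_of_lt hi, Nat.mod_eq_of_lt hj, Nat.mod_eq_of_lt ha,
        Nat.mod_eq_of_lt hb] using hij
    · intro x y hxy
      simpa using multiW_ne_zero hxy
    · rintro ⟨i, a⟩ ⟨hi, ha⟩ ⟨j, b⟩ ⟨hj, hb⟩
      simp only at hi ha hj hb
      simp [multiW, hi, ha, hj, hb, Fin.ext_iff, Nat.mod_eq_of_lt]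
    · have hmem : ∀ u : Fin m × Fin n, u ∈ (fun x : ℕ × ℕ => (Fin.ofNat m x.1, Fin.ofNat n x.2)) ''
          {x | x.1 < m ∧ x.2 < n} := fun u => ⟨(u.1, u.2), ⟨u.1.2, u.2.2⟩, by simp⟩
      exact fun u v _ => ⟨hmem u, hmem v⟩
  exact isPathCycleDecomposable_of_dec hd fun x y => (mult_equipartite x y).symm

end Equipartite

end PathCycle

open PathCycle in
theorem mainTheorem2 (m n l : ℕ) (hm : 2 ≤ m) (hn : 1 ≤ n) (hl : 1 ≤ l) :
    ((((⊤ : SimpleGraph (Fin m)).wreathProduct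
        (⊥ : SimpleGraph (Fin n))).fold l).AdmitsPathCycleDecomposition 8 ↔
      8 ∣ l * n ^ 2 * m * (m - 1) / 2 ∧ 9 ≤ m * n) ∧
    ∀ p q : ℕ, 1 ≤ p →
      (((⊤ : SimpleGraph (Fin m)).wreathProduct
        (⊥ : SimpleGraph (Fin n))).fold l).IsPathCycleDecomposable 8 p q →
      8 ∣ l * n ^ 2 * m * (m - 1) / 2 ∧ 9 ≤ m * n := by
  have hE := two_mul_edgeCount_equipartite (m := m) (n := n) (l := l)
  rw [← edgeCount_equipartite]
  change ((equipartite m n l).AdmitsPathCycleDecomposition 8 ↔ _) ∧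
    ∀ p q : ℕ, 1 ≤ p → (equipartite m n l).IsPathCycleDecomposable 8 p q → _
  set M := equipartite m n l with hM
  have hpos : 0 < l * n ^ 2 * m * (m - 1) := by
    have : 0 < m - 1 := by omega
    positivity
  -- a single path already gives the two conditions
  have main : ∀ p q : ℕ, 1 ≤ p → M.IsPathCycleDecomposable 8 p q → 8 ∣ M.edgeCount ∧ 9 ≤ m * n := by
    intro p q hp h
    refine ⟨⟨_, edgeCount_of_isPathCycleDecomposable h⟩, ?_⟩
    obtain ⟨P, -, -⟩ := h
    have := Fintype.card_le_of_injective _ (P ⟨0, hp⟩).injective'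
    simpa using this
  refine ⟨⟨?_, ?_⟩, main⟩
  · rintro ⟨⟨p, q, h⟩, hadm⟩
    rcases Nat.eq_zero_or_pos p with rfl | hp
    swap
    · exact main p q hp h
    have hq := edgeCount_of_isPathCycleDecomposable h
    rw [zero_add] at hq
    by_contra hcon
    have hmn : m * n ≤ 8 := by
      by_contra hmn
      exact hcon ⟨⟨q, hq⟩, by omega⟩
    -- with at most `8` vertices all pieces are cycles, so that there are exactly `8` vertices
    have hq₀ : 0 < q := by omega
    have h₈ : 8 ≤ m * n := by
      obtain ⟨-, C, -⟩ := h
      have := Fintype.card_le_of_injective _ (C ⟨0, hq₀⟩).injective'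
      simpa using this
    have hm₈ : m ≤ 8 := (Nat.le_mul_of_pos_right m hn).trans hmn
    have hn₈ : n ≤ 8 := (Nat.le_mul_of_pos_left n (by omega)).trans hmn
    -- but then all degrees are even, and decompositions into paths only are admissible
    have key : ¬ Odd (l * (n * (m - 1))) ∧ q ≠ 1 := by
      rw [hq] at hE
      rw [Nat.odd_iff]
      interval_cases m <;> interval_cases n <;> omega
    have hdec := hadm q 0 ⟨by omega, by rw [hM, oddCount_equipartite_of_not_odd key.1]; omega,
      fun _ => key.2⟩
    exact hcon (main q 0 hq₀ hdec)
  · rintro ⟨h₈, hmn⟩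
    have h₁₆ : 16 ∣ l * n ^ 2 * m * (m - 1) := by
      rw [← hE]
      omega
    have hdec : ∀ {p q : ℕ}, Dec (multiW n l (Finset.range m)) p q →
        M.IsPathCycleDecomposable 8 p q := fun h =>
      isPathCycleDecomposable_of_dec_multiW h (by omega) (by omega)
    by_cases hodd : Odd l ∧ Odd n ∧ Even m
    · obtain ⟨N, k, hk, hkN, hR⟩ := exists_hasRange_of_odd hodd.2.1 hodd.1 hodd.2.2 (by omega) h₁₆
        (Finset.card_range m)
      have hN := edgeCount_of_isPathCycleDecomposable (hdec (hR N 0 rfl hkN))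
      have hdeg : Odd (l * (n * (m - 1))) := by
        refine hodd.1.mul (hodd.2.1.mul ?_)
        have := hodd.2.2
        rw [Nat.even_iff] at this
        rw [Nat.odd_iff]
        omega
      refine ⟨⟨N, 0, hdec (hR N 0 rfl hkN)⟩, ?_⟩
      rintro p q ⟨h, h₁, -⟩
      rw [hM, oddCount_equipartite_of_odd hdeg] at h₁
      exact hdec (hR p q (by omega) (by omega))
    · obtain ⟨N, -, -, hF⟩ := fullMulti_of_dvd hmn h₁₆ hodd (Finset.range m) (Finset.card_range m)
      have hN := edgeCount_of_isPathCycleDecomposable (hdec (hF 0 N (by omega) (by omega)))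
      have hnot : ¬ Odd (l * (n * (m - 1))) := by
        rw [Nat.odd_mul, Nat.odd_mul]
        rintro ⟨h₁, h₂, h₃⟩
        refine hodd ⟨h₁, h₂, ?_⟩
        rw [Nat.even_iff]
        rw [Nat.odd_iff] at h₃
        omega
      refine ⟨⟨0, N, hdec (hF 0 N (by omega) (by omega))⟩, ?_⟩
      rintro p q ⟨h, -, h₁⟩
      exact hdec (hF p q (by omega) (h₁ (by rw [hM, oddCount_equipartite_of_not_odd hnot])))
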